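/- Let $(X,d)$ be a proper geodesic metric space with a base point $o$, and let $G$ be a (discrete) group acting properly by isometries on $X$. For $S\subseteq G$ put $$\omega(S,X)=\limsup_{\ell\to\infty}\frac1\ell\ln\#\{g\in S: d(o,go)\le \ell\}\in[-\infty,+\infty],\qquad \omega_G=\omega(G,X).$$ For a compact set $K\subseteq X$ let $G_K$ be the set of all $g\in G$ for which there are $x,y\in K$ and a geodesic $\gamma$ from $x$ to $gy$ with $\gamma\cap GK\subseteq K\cup gK$. The entropy at infinity is $\omega_\infty(G,X)=\inf_K\omega(G_K,X)$, where $K$ runs over all non-empty compact subsets of $X$, and the action is called strongly positively recurrent if $\omega_\infty(G,X)<\omega_G$. Let $C^*(X)$ be the space of continuous cocycles $c:X\times X\to\mathbb R$ (that is, $c(x,z)=c(x,y)+c(y,z)$ for all $x,y,z$) with the topology of uniform convergence on compact sets. Let $\bar X$ be the closure in $C^*(X)$ of the image of $\iota:X\to C^*(X)$, $\iota(z)(x,y)=d(x,z)-d(y,z)$, and let $\partial X=\bar X\setminus\iota(X)$. The group $G$ acts on $\bar X$ by $(gc)(x,y)=c(g^{-1}x,g^{-1}y)$. A density is a family $\nu=(\nu_x)_{x\in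 X}$ of finite Borel measures on $\bar X$ with $\nu_x\ll\nu_y$ for all $x,y\in X$ and $\nu_o(\bar X)=1$. It is $G$-invariant if $g_*\nu_x=\nu_{gx}$ for all $g\in G$ and $x\in X$, and $\omega$-conformal if, for all $x,y\in X$, $\frac{d\nu_x}{d\nu_y}(c)=e^{-\omega c(x,y)}$ for $\nu_y$-almost every $c$. For $x,y\in X$ and $r\ge0$ let $\mathcal O_x(y,r)=\{c\in\bar X:\tfrac12[d(x,y)+c(y,x)]\le r\}$. Let $\Lambda_{\rm rad}(G,o,r)$ be the set of $c\in\partial X$ such that for every $T\ge0$ there is $g\in G$ with $d(o,go)\ge T$ and $c\in\mathcal O_o(go,r)$. The radial limit set is $\Lambda_{\rm rad}(G)=\bigcup_{r\ge0}G\,\Lambda_{\rm rad}(G,o,r)$. **Proposition.** If the action of $G$ on $X$ is strongly positively recurrent, then $\omega_G$ is finite and there is a $G$-invariant, $\omega_G$-conformal density $\nu=(\nu_x)$ on $\bar X$ which gives full measure to the radial limit set, i.e. $\nu_x(\bar X\setminus\Lambda_{\rm rad}(G))=0$ for every $x\in X$. Moreover the action is divergent: the Poincaré series $\sum_{g\in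 G}e^{-s\,d(o,go)}$ diverges at $s=\omega_G$. (No contracting element in $G$ is assumed.) -/

import Mathlib

open Set Filter Topology MeasureTheory
open scoped Pointwise ENNReal

noncomputable section

section Geodesics

variable {X : Type*} [MetricSpace X]

/-- `γ`, restricted to `[0, dist x y]`, is a geodesic joining `x` to `y`. -/
structure IsGeodesicSegment (γ : ℝ → X) (x y : X) : Prop where
  source : γ 0 = x
  target : γ (dist x y) = y
  isometric : ∀ s ∈ Icc (0 : ℝ) (dist x y), ∀ t ∈ Icc (0 : ℝ) (dist x y),
    dist (γ s) (γ t) = |s - t|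

variable (X) in
/-- Any two points are joined by a (not necessarily unique) geodesic. -/
def IsGeodesicSpace : Prop :=
  ∀ x y : X, ∃ γ : ℝ → X, IsGeodesicSegment γ x y

end Geodesics

section Growth

variable {G X : Type*} [Group G] [MetricSpace X] [MulAction G X]

/-- The exponential growth rate of a subset `S ⊆ G`:
`limsup_{ℓ → ∞} (1 / ℓ) log #{g ∈ S | dist o (g o) ≤ ℓ}`, as an extended real number. -/
def growthRate (S : Set G) (o : X) : EReal :=
  limsup (fun ℓ : ℝ =>
    ENNReal.log (({g ∈ S | dist o (g • o) ≤ ℓ}.encard : ℕ∞) : ℝ≥0∞) / (ℓ : EReal)) atTop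

variable (G) in
/-- The growth rate `ω_G` of the whole group. -/
def groupGrowthRate (o : X) : EReal := growthRate (Set.univ : Set G) o

variable (G) in
/-- The set `G_K`: there are `x, y ∈ K` and a geodesic `γ` from `x` to `g y` with
`γ ∩ G K ⊆ K ∪ g K`. -/
def awaySet (K : Set X) : Set G :=
  {g | ∃ x ∈ K, ∃ y ∈ K, ∃ γ : ℝ → X, IsGeodesicSegment γ x (g • y) ∧
    γ '' Icc (0 : ℝ) (dist x (g • y)) ∩ (⋃ h : G, h • K) ⊆ K ∪ g • K}

variable (G) in
/-- The entropy at infinity, the infimum of the growth rates of the sets `G_K` over the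
(non-empty) compact subsets `K`. -/
def entropyAtInfinity (o : X) : EReal :=
  ⨅ (K : Set X) (_ : IsCompact K) (_ : K.Nonempty), growthRate (awaySet G K) o

variable (G) in
/-- Strongly positively recurrent (statistically convex co-compact) action. -/
def IsStronglyPositivelyRecurrent (o : X) : Prop :=
  entropyAtInfinity G o < groupGrowthRate G o

variable (G) in
/-- The Poincaré series `∑ g, exp (-s * dist o (g o))` diverges at `s = ω_G`. -/
def IsDivergentAction (o : X) : Prop :=
  ∃ ω : ℝ, (ω : EReal) = groupGrowthRate G o ∧
    ¬ Summable (fun g : G => Real.exp (-ω * dist o (g • o)))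

end Growth

section Horocompactification

/-- Continuous cocycles `c : X × X → ℝ`. -/
def ContinuousCocycle (X : Type*) [TopologicalSpace X] : Type _ :=
  {c : C(X × X, ℝ) // ∀ x y z : X, c (x, z) = c (x, y) + c (y, z)}

/-- The topology of uniform convergence on compact subsets (the compact-open topology). -/
instance ContinuousCocycle.instTopologicalSpace (X : Type*) [TopologicalSpace X] :
    TopologicalSpace (ContinuousCocycle X) :=
  instTopologicalSpaceSubtype

variable {X : Type*} [MetricSpace X]

/-- The cocycle `b_z (x, y) = dist x z - dist y z`. -/
def pointCocycle (z : X) : ContinuousCocycle X :=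
  ⟨⟨fun p => dist p.1 z - dist p.2 z, by fun_prop⟩, fun x y w => by simp⟩

variable (X) in
/-- The horocompactification: the closure of the image of `z ↦ b_z` in the space of continuous
cocycles. -/
def Horocompactification : Type _ :=
  {c : ContinuousCocycle X // c ∈ closure (range (pointCocycle (X := X)))}

instance Horocompactification.instTopologicalSpace :
    TopologicalSpace (Horocompactification X) :=
  instTopologicalSpaceSubtype

/-- The Borel `σ`-algebra of the horocompactification. -/
instance Horocompactification.instMeasurableSpace :
    MeasurableSpace (Horocompactification X) :=
  borel _

instance Horocompactification.instBorelSpace : BorelSpace (Horocompactification X) := ⟨rfl⟩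

/-- The value `c (x, y)` of a point `c` of the horocompactification. -/
def Horocompactification.eval (c : Horocompactification X) (x y : X) : ℝ := c.1.1 (x, y)

/-- The embedding of `X` in its horocompactification. -/
def Horocompactification.ofPoint (z : X) : Horocompactification X :=
  ⟨pointCocycle z, subset_closure ⟨z, rfl⟩⟩

variable (X) in
/-- The horoboundary: the horocompactification minus the image of `X`. -/
def horoboundary : Set (Horocompactification X) :=
  (range (Horocompactification.ofPoint (X := X)))ᶜ

section Action

variable {G : Type*} [Group G] [MulAction G X] [IsIsometricSMul G X]

/-- `(g c) (x, y) = c (g⁻¹ x, g⁻¹ y)`. -/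
def ContinuousCocycle.act (g : G) (c : ContinuousCocycle X) : ContinuousCocycle X :=
  ⟨c.1.comp ⟨fun p => (g⁻¹ • p.1, g⁻¹ • p.2),
      ((isometry_smul X g⁻¹).continuous.comp continuous_fst).prodMk
        ((isometry_smul X g⁻¹).continuous.comp continuous_snd)⟩,
    fun _ _ _ => c.2 _ _ _⟩

theorem ContinuousCocycle.continuous_act (g : G) :
    Continuous (ContinuousCocycle.act (X := X) g) :=
  ((ContinuousMap.continuous_precomp _).comp continuous_subtype_val).subtype_mk _

theorem ContinuousCocycle.act_pointCocycle (g : G) (z : X) :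
    ContinuousCocycle.act g (pointCocycle z) = pointCocycle (g • z) := by
  apply Subtype.ext
  ext ⟨x, y⟩
  have h : ∀ w : X, dist (g⁻¹ • w) z = dist w (g • z) := fun w => by
    rw [← dist_smul g (g⁻¹ • w) z, smul_inv_smul]
  change dist (g⁻¹ • x) z - dist (g⁻¹ • y) z = dist x (g • z) - dist y (g • z)
  rw [h, h]

theorem ContinuousCocycle.act_mem_closure (g : G) {c : ContinuousCocycle X}
    (hc : c ∈ closure (range (pointCocycle (X := X)))) :
    ContinuousCocycle.act g c ∈ closure (range (pointCocycle (X := X))) := by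
  refine map_mem_closure (ContinuousCocycle.continuous_act g) hc ?_
  rintro _ ⟨z, rfl⟩
  exact ⟨g • z, (ContinuousCocycle.act_pointCocycle g z).symm⟩

/-- The action of `G` on the horocompactification extending the action on `X`. -/
instance Horocompactification.instMulAction : MulAction G (Horocompactification X) where
  smul g c := ⟨ContinuousCocycle.act g c.1, ContinuousCocycle.act_mem_closure g c.2⟩
  one_smul c := by
    apply Subtype.ext
    apply Subtype.ext
    ext ⟨x, y⟩
    change c.1.1 ((1 : G)⁻¹ • x, (1 : G)⁻¹ • y) = c.1.1 (x, y)
    simp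
  mul_smul g h c := by
    apply Subtype.ext
    apply Subtype.ext
    ext ⟨x, y⟩
    change c.1.1 ((g * h)⁻¹ • x, (g * h)⁻¹ • y) = c.1.1 (h⁻¹ • g⁻¹ • x, h⁻¹ • g⁻¹ • y)
    simp [mul_smul]

/-- Each `g` acts on the horocompactification by a homeomorphism; in particular the
push-forwards of Borel measures by `g` are the genuine ones. -/
instance Horocompactification.instContinuousConstSMul :
    ContinuousConstSMul G (Horocompactification X) where
  continuous_const_smul g :=
    ((ContinuousCocycle.continuous_act g).comp continuous_subtype_val).subtype_mk _

end Action

/-- The Gromov product `⟨x, c⟩_y = (dist x y + c (y, x)) / 2`. -/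
def horoGromovProduct (x : X) (c : Horocompactification X) (y : X) : ℝ :=
  (dist x y + c.eval y x) / 2

/-- The `r`-shadow of `y` seen from `x`. -/
def shadow (x y : X) (r : ℝ) : Set (Horocompactification X) :=
  {c | horoGromovProduct x c y ≤ r}

variable (G : Type*) [Group G] [MulAction G X]

/-- The set `Λ_rad (G, x, r)`, with respect to the base point `o`. -/
def radialLimitSetAt (o x : X) (r : ℝ) : Set (Horocompactification X) :=
  {c | c ∈ horoboundary X ∧
    ∀ T : ℝ, 0 ≤ T → ∃ g : G, T ≤ dist x (g • o) ∧ c ∈ shadow x (g • o) r}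

/-- The radial limit set `⋃ r ≥ 0, G Λ_rad (G, o, r)`. -/
def radialLimitSet [IsIsometricSMul G X] (o : X) : Set (Horocompactification X) :=
  {c | ∃ r : ℝ, 0 ≤ r ∧ ∃ g : G, c ∈ g • radialLimitSetAt G o o r}

end Horocompactification

section Densities

variable {X : Type*} [MetricSpace X]

/-- A density on the horocompactification with its Borel `σ`-algebra, normalized at `o`. -/
structure IsDensity (o : X) (ν : X → Measure (Horocompactification X)) : Prop where
  finite : ∀ x, IsFiniteMeasure (ν x)
  absolutelyContinuous : ∀ x y, ν x ≪ ν y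
  normalized : ν o Set.univ = 1

/-- `g_* ν_x = ν_{g x}` for all `g` and `x`. -/
def IsInvariantDensity (G : Type*) [Group G] [MulAction G X] [IsIsometricSMul G X]
    (ν : X → Measure (Horocompactification X)) : Prop :=
  ∀ (g : G) (x : X), (ν x).map (fun c => g • c) = ν (g • x)

/-- `dν_x / dν_y (c) = exp (-ω c (x, y))` for `ν_y`-almost every `c`, for all `x` and `y`. -/
def IsConformalDensity (ω : ℝ) (ν : X → Measure (Horocompactification X)) : Prop :=
  ∀ x y : X, (ν x).rnDeriv (ν y) =ᵐ[ν y]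
    fun c => ENNReal.ofReal (Real.exp (-ω * c.eval x y))

end Densities

end

/-!
The action of `G` is divergent for a reason that needs no boundary. Fix a compact set `K` such that
`G_K` has growth rate less than `ω_G`, write `|g|` for `dist o (g • o)`, and let `σ` lie strictly
between the two rates. A geodesic from `K` to `h • K`, cut at the last time before `t` and at the
first time after `t` at which it meets `G K`, writes `h = u * v * w` with `v ∈ G_K` and
`|u| + |v| + |w| ≤ |h| + const` (`exists_excursion`). Hence
`F t = ∑_{|g| ≤ t} exp (-σ |g|)` satisfies `F (t + t') ≤ C * F (t + D) * F (t' + D)`, where `C`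
contains the convergent sum of `exp (-σ |v|)` over `G_K` (`poincareSeries_orbitBall_add_le`).
A Fekete argument (`groupGrowthRate_le_of_submultiplicative`) then shows that `ω_G` is finite and
that `F t` is at least a multiple of `exp ((ω_G - σ) t)`. If the Poincaré series converged at
`ω_G`, dominated convergence would make `F t` negligible with respect to `exp ((ω_G - σ) t)`
(`tendsto_exp_mul_poincareSeries_orbitBall`), a contradiction.

Since the series diverges, Patterson's construction works without modified weights: the
horocompactification is compact by Arzelà–Ascoli, the normalized orbital measures at exponents
`s > ω_G` are quasi-invariant, and a weak limit `ν` as `s → ω_G` is quasi-invariant with exponent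
`ω_G` (`exists_limit_orbitMeasure`). The density is `exp (-ω_G c (x, o)) ν`.

For the radial limit set, a point of its complement, be it a point of `X` or of the horoboundary,
avoids for some `T₀` the shadows of radius `r` of all orbit points with `T₀ ≤ |g|`. For fixed `T₁`,
to avoid the shadows with `T₀ ≤ |g| ≤ T₁` is an open condition, and an orbit point `h • o` far from
`o` satisfies it only if a geodesic towards it makes an excursion of length about `T₁ - T₀` outside
`G K`. The decomposition `h = u * v * w` bounds the mass of such orbit points by a multiple of the
tail `∑ exp (-s |v|)` over `v ∈ G_K` with `|v| ≥ T₁ - T₀ - const`, uniformly in `s ≥ ω_G`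
(`poincareSeries_outsideShadows_le`); the remaining finitely many orbit points are negligible as
`s → ω_G` because the series diverges. Letting `T₁ → ∞` shows that the complement is `ν`-null
(`ae_mem_radialLimitSet`).
-/

noncomputable section

/-! ### Poincaré series and growth rates -/

section PoincareSeries

variable {G X : Type*} [Group G] [MetricSpace X] [MulAction G X]

/-- The Poincaré series `∑ g ∈ S, exp (-s * dist o (g • o))` of a subset `S` of the group, with
values in `[0, ∞]`, so that no summability has to be carried along. -/
def poincareSeries (o : X) (s : ℝ) (S : Set G) : ℝ≥0∞ :=
  ∑' g : S, ENNReal.ofReal (Real.exp (-s * dist o ((g : G) • o)))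

variable (G) in
/-- The elements of `G` moving the base point `o` by at most `t`. -/
def orbitBall (o : X) (t : ℝ) : Set G := {g | dist o (g • o) ≤ t}

theorem poincareSeries_mono_set (o : X) (s : ℝ) {S T : Set G} (h : S ⊆ T) :
    poincareSeries o s S ≤ poincareSeries o s T :=
  ENNReal.tsum_mono_subtype
    (fun g : G => ENNReal.ofReal (Real.exp (-s * dist o (g • o)))) h

theorem poincareSeries_union_le (o : X) (s : ℝ) (S T : Set G) :
    poincareSeries o s (S ∪ T) ≤ poincareSeries o s S + poincareSeries o s T :=
  ENNReal.tsum_union_le (fun g : G => ENNReal.ofReal (Real.exp (-s * dist o (g • o)))) S T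

theorem poincareSeries_anti (o : X) {s s' : ℝ} (h : s ≤ s') (S : Set G) :
    poincareSeries o s' S ≤ poincareSeries o s S := by
  refine ENNReal.tsum_le_tsum fun g => ENNReal.ofReal_le_ofReal (Real.exp_le_exp.2 ?_)
  have := mul_le_mul_of_nonneg_right h (dist_nonneg (x := o) (y := (g : G) • o))
  linarith

theorem poincareSeries_univ (o : X) (s : ℝ) :
    poincareSeries o s (univ : Set G) =
      ∑' g : G, ENNReal.ofReal (Real.exp (-s * dist o (g • o))) :=
  tsum_univ (fun g : G => ENNReal.ofReal (Real.exp (-s * dist o (g • o))))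

theorem one_le_poincareSeries (o : X) (s : ℝ) {S : Set G} (h : (1 : G) ∈ S) :
    1 ≤ poincareSeries o s S := by
  refine le_trans ?_ (ENNReal.le_tsum (⟨1, h⟩ : S))
  simp

theorem poincareSeries_lt_top_of_finite (o : X) (s : ℝ) {S : Set G} (h : S.Finite) :
    poincareSeries o s S < ⊤ := by
  have := h.fintype
  rw [poincareSeries, tsum_fintype]
  exact ENNReal.sum_lt_top.2 fun _ _ => ENNReal.ofReal_lt_top

/-- If every element of `A` is a product of elements of `U`, `V` and `W` whose lengths add up to
at most its own length plus `D`, then the Poincaré series of `A` is at most the product of the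
three other ones, up to the factor `exp (s * D)`. -/
theorem poincareSeries_le_mul (o : X) {s : ℝ} (hs : 0 ≤ s) (D : ℝ) {A U V W : Set G}
    (h : ∀ g ∈ A, ∃ u ∈ U, ∃ v ∈ V, ∃ w ∈ W, g = u * v * w ∧
      dist o (u • o) + dist o (v • o) + dist o (w • o) ≤ dist o (g • o) + D) :
    poincareSeries o s A ≤ ENNReal.ofReal (Real.exp (s * D)) *
      (poincareSeries o s U * poincareSeries o s V * poincareSeries o s W) := by
  choose! u hu v hv w hw hg hd using h
  set f : G → ℝ≥0∞ := fun g => ENNReal.ofReal (Real.exp (-s * dist o (g • o))) with hf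
  let φ : A → U × V × W := fun g => (⟨u g, hu g g.2⟩, ⟨v g, hv g g.2⟩, ⟨w g, hw g g.2⟩)
  have hφ : Function.Injective φ := by
    intro a b hab
    simp only [φ, Prod.mk.injEq, Subtype.mk.injEq] at hab
    apply Subtype.ext
    rw [hg a a.2, hg b b.2, hab.1, hab.2.1, hab.2.2]
  have key : ∀ g : A, f g ≤ ENNReal.ofReal (Real.exp (s * D)) *
      (f (φ g).1 * f (φ g).2.1 * f (φ g).2.2) := by
    intro g
    simp only [hf, φ]
    rw [← ENNReal.ofReal_mul (by positivity), ← ENNReal.ofReal_mul (by positivity),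
      ← ENNReal.ofReal_mul (by positivity), ← Real.exp_add, ← Real.exp_add, ← Real.exp_add]
    refine ENNReal.ofReal_le_ofReal (Real.exp_le_exp.2 ?_)
    have := mul_le_mul_of_nonneg_left (hd g g.2) hs
    linarith
  calc poincareSeries o s A = ∑' g : A, f g := rfl
    _ ≤ ∑' g : A, ENNReal.ofReal (Real.exp (s * D)) *
          (f (φ g).1 * f (φ g).2.1 * f (φ g).2.2) := ENNReal.tsum_le_tsum key
    _ ≤ ∑' p : U × V × W, ENNReal.ofReal (Real.exp (s * D)) * (f p.1 * f p.2.1 * f p.2.2) :=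
        ENNReal.tsum_comp_le_tsum_of_injective hφ
          (fun p : U × V × W => ENNReal.ofReal (Real.exp (s * D)) * (f p.1 * f p.2.1 * f p.2.2))
    _ = _ := by
        rw [ENNReal.tsum_mul_left, ENNReal.tsum_prod']
        simp_rw [ENNReal.tsum_prod', ENNReal.tsum_mul_left, ENNReal.tsum_mul_right,
          ENNReal.tsum_mul_left]
        rw [ENNReal.tsum_mul_right]
        rfl

theorem encard_orbitBall_le (o : X) {s : ℝ} (hs : 0 ≤ s) (t : ℝ) :
    (((orbitBall G o t).encard : ℕ∞) : ℝ≥0∞) ≤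
      ENNReal.ofReal (Real.exp (s * t)) * poincareSeries o s (orbitBall G o t) := by
  rw [← ENat.card_coe_set_eq, ← ENNReal.tsum_one, poincareSeries, ← ENNReal.tsum_mul_left]
  refine ENNReal.tsum_le_tsum fun g => ?_
  rw [← ENNReal.ofReal_mul (by positivity), ← Real.exp_add, ENNReal.one_le_ofReal,
    Real.one_le_exp_iff]
  have := mul_le_mul_of_nonneg_left (show dist o ((g : G) • o) ≤ t from g.2) hs
  linarith

section Growth

theorem log_div_le_of_le_exp {c : ℝ≥0∞} {s ℓ : ℝ} (hℓ : 0 < ℓ)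
    (h : c ≤ ENNReal.ofReal (Real.exp (s * ℓ))) : ENNReal.log c / (ℓ : EReal) ≤ s := by
  rw [EReal.div_le_iff_le_mul (by exact_mod_cast hℓ) (EReal.coe_ne_top _)]
  refine (ENNReal.log_le_log h).trans ?_
  rw [ENNReal.log_ofReal_of_pos (Real.exp_pos _), Real.log_exp, mul_comm]
  exact_mod_cast le_rfl

theorem le_exp_of_log_div_le {c : ℝ≥0∞} {s ℓ : ℝ} (hℓ : 0 < ℓ)
    (h : ENNReal.log c / (ℓ : EReal) ≤ s) : c ≤ ENNReal.ofReal (Real.exp (s * ℓ)) := by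
  rw [EReal.div_le_iff_le_mul (by exact_mod_cast hℓ) (EReal.coe_ne_top _)] at h
  rw [← ENNReal.log_le_log_iff, ENNReal.log_ofReal_of_pos (Real.exp_pos _), Real.log_exp, mul_comm]
  exact_mod_cast h

theorem growthRate_nonneg {S : Set G} (h : (1 : G) ∈ S) (o : X) : 0 ≤ growthRate S o := by
  refine le_limsup_of_frequently_le (Eventually.frequently ?_)
  filter_upwards [eventually_ge_atTop (0 : ℝ)] with ℓ hℓ
  refine EReal.div_nonneg ?_ (by exact_mod_cast hℓ)
  rw [ENNReal.zero_le_log_iff]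
  have : (1 : ℕ∞) ≤ {g ∈ S | dist o (g • o) ≤ ℓ}.encard := by
    rw [one_le_encard_iff_nonempty]
    exact ⟨1, h, by simpa using hℓ⟩
  exact_mod_cast this

theorem groupGrowthRate_le_of_encard_le (o : X) {s : ℝ} {C : ℝ}
    (h : ∀ ℓ : ℝ, 0 ≤ ℓ → (((orbitBall G o ℓ).encard : ℕ∞) : ℝ≥0∞) ≤
      ENNReal.ofReal (Real.exp (s * ℓ + C))) : groupGrowthRate G o ≤ s := by
  refine EReal.le_of_forall_lt_iff_le.1 fun s' hs' => ?_
  have hs' : s < s' := by exact_mod_cast hs'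
  refine limsup_le_of_le (h := ?_)
  filter_upwards [eventually_gt_atTop (0 : ℝ), eventually_ge_atTop (C / (s' - s))] with ℓ h0 h1
  refine log_div_le_of_le_exp h0 ?_
  have : {g ∈ (univ : Set G) | dist o (g • o) ≤ ℓ} = orbitBall G o ℓ := by
    ext; simp [orbitBall]
  rw [this]
  refine (h ℓ h0.le).trans (ENNReal.ofReal_le_ofReal (Real.exp_le_exp.2 ?_))
  rw [div_le_iff₀ (by linarith)] at h1
  linarith

variable [ProperSpace X] [ProperlyDiscontinuousSMul G X]

variable (G) in
theorem finite_orbitBall (o : X) (t : ℝ) : (orbitBall G o t).Finite := by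
  refine (ProperlyDiscontinuousSMul.finite_disjoint_inter_image (Γ := G)
    (isCompact_singleton (x := o)) (isCompact_closedBall o t)).subset fun g hg => ?_
  refine ⟨g • o, ⟨o, rfl, rfl⟩, ?_⟩
  rw [Metric.mem_closedBall, dist_comm]
  exact hg

/-- The Poincaré series converges above the growth rate. -/
theorem poincareSeries_lt_top_of_growthRate_lt {S : Set G} {o : X} {s : ℝ} (hs : 0 < s)
    (h : growthRate S o < s) : poincareSeries o s S < ⊤ := by
  obtain ⟨s₁, h1, h1s⟩ := EReal.exists_between_coe_real h
  have h1s : s₁ < s := by exact_mod_cast h1s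
  obtain ⟨s', hs1, hs's⟩ := exists_between (max_lt h1s hs)
  have hs'0 : 0 < s' := (le_max_right _ _).trans_lt hs1
  set N : ℝ → ℝ≥0∞ := fun ℓ => (({g ∈ S | dist o (g • o) ≤ ℓ}.encard : ℕ∞) : ℝ≥0∞) with hN
  have hmono : Monotone N := fun a b hab => by
    have : {g ∈ S | dist o (g • o) ≤ a}.encard ≤ {g ∈ S | dist o (g • o) ≤ b}.encard :=
      encard_le_encard fun g hg => ⟨hg.1, hg.2.trans hab⟩
    simp only [hN]; exact_mod_cast this
  have hfin : ∀ ℓ, N ℓ < ⊤ := fun ℓ => by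
    have : {g ∈ S | dist o (g • o) ≤ ℓ}.Finite :=
      (finite_orbitBall G o ℓ).subset fun g hg => hg.2
    have := this.encard_lt_top
    simp only [hN]; exact_mod_cast this
  have hev : ∀ᶠ ℓ : ℝ in atTop, N ℓ ≤ ENNReal.ofReal (Real.exp (s' * ℓ)) := by
    filter_upwards [eventually_lt_of_limsup_lt h1, eventually_gt_atTop (0 : ℝ)] with ℓ hl h0
    refine le_exp_of_log_div_le h0 (hl.le.trans ?_)
    exact_mod_cast (le_max_left _ _).trans hs1.le
  obtain ⟨ℓ₀, hℓ₀⟩ := eventually_atTop.1 hev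
  have hbound : ∀ n : ℕ, N n ≤ (N ℓ₀ + 1) * ENNReal.ofReal (Real.exp (s' * n)) := by
    intro n
    rcases le_total ℓ₀ n with hn | hn
    · exact (hℓ₀ n hn).trans (le_mul_of_one_le_left' le_add_self)
    · refine ((hmono hn).trans le_self_add).trans (le_mul_of_one_le_right' ?_)
      rw [ENNReal.one_le_ofReal, Real.one_le_exp_iff]
      positivity
  -- each term is dominated by the term `n = ⌈dist o (g • o)⌉₊` of a sum over `n`
  have hterm : ∀ g : S, ENNReal.ofReal (Real.exp (-s * dist o ((g : G) • o))) ≤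
      ∑' n : ℕ, {g : S | dist o ((g : G) • o) ≤ n}.indicator
        (fun _ => ENNReal.ofReal (Real.exp (-s * (n - 1)))) g := by
    intro g
    refine le_trans ?_ (ENNReal.le_tsum ⌈dist o ((g : G) • o)⌉₊)
    have hmem : g ∈ {g' : S | dist o ((g' : G) • o) ≤ ⌈dist o ((g : G) • o)⌉₊} :=
      mem_ofPred_eq ▸ Nat.le_ceil _
    rw [indicator_of_mem hmem]
    refine ENNReal.ofReal_le_ofReal (Real.exp_le_exp.2 ?_)
    have := (Nat.ceil_lt_add_one (dist_nonneg (x := o) (y := (g : G) • o))).le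
    have := mul_le_mul_of_nonneg_left this hs.le
    linarith
  have hcount : ∀ (n : ℕ) (a : ℝ≥0∞),
      ∑' g : S, {g : S | dist o ((g : G) • o) ≤ n}.indicator (fun _ => a) g = N n * a := by
    intro n a
    rw [← tsum_subtype, ENNReal.tsum_const, ENat.card_coe_set_eq]
    congr 2
    rw [← Subtype.val_injective.encard_image]
    congr 1
    ext g
    simp [and_comm]
  have hr : ENNReal.ofReal (Real.exp (-(s - s'))) < 1 := by
    rw [ENNReal.ofReal_lt_one, Real.exp_lt_one_iff]; linarith
  calc poincareSeries o s S
      ≤ ∑' g : S, ∑' n : ℕ, {g : S | dist o ((g : G) • o) ≤ n}.indicator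
        (fun _ => ENNReal.ofReal (Real.exp (-s * (n - 1)))) g := ENNReal.tsum_le_tsum hterm
    _ = ∑' n : ℕ, N n * ENNReal.ofReal (Real.exp (-s * (n - 1))) := by
        rw [ENNReal.tsum_comm]
        exact tsum_congr fun n => hcount n _
    _ ≤ ∑' n : ℕ, (N ℓ₀ + 1) * ENNReal.ofReal (Real.exp s) *
          ENNReal.ofReal (Real.exp (-(s - s'))) ^ n := by
        refine ENNReal.tsum_le_tsum fun n => (mul_le_mul_left (hbound n) _).trans ?_
        rw [mul_assoc, mul_assoc, ← ENNReal.ofReal_pow (by positivity), ← Real.exp_nat_mul,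
          ← ENNReal.ofReal_mul (by positivity), ← ENNReal.ofReal_mul (by positivity),
          ← Real.exp_add, ← Real.exp_add]
        apply le_of_eq
        congr 3
        ring
    _ < ⊤ := by
        rw [ENNReal.tsum_mul_left, ENNReal.tsum_geometric]
        refine ENNReal.mul_lt_top (ENNReal.mul_lt_top ?_ ENNReal.ofReal_lt_top) ?_
        · exact ENNReal.add_lt_top.2 ⟨hfin _, ENNReal.one_lt_top⟩
        · rw [ENNReal.inv_lt_top]
          exact tsub_pos_of_lt hr

end Growth

end PoincareSeries

/-! ### Excursions of geodesics outside the orbit of a compact set -/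

section Excursion

variable {G X : Type*} [Group G] [MetricSpace X] [MulAction G X]

theorem IsGeodesicSegment.continuousOn {γ : ℝ → X} {x y : X} (h : IsGeodesicSegment γ x y) :
    ContinuousOn γ (Icc 0 (dist x y)) := by
  refine LipschitzOnWith.continuousOn (K := 1) (LipschitzOnWith.of_dist_le_mul fun s hs t ht => ?_)
  rw [h.isometric s hs t ht, Real.dist_eq, NNReal.coe_one, one_mul]

theorem IsGeodesicSegment.translate_subsegment [IsIsometricSMul G X] {γ : ℝ → X} {x y : X}
    (h : IsGeodesicSegment γ x y) {a b : ℝ} (ha : 0 ≤ a) (hab : a ≤ b) (hb : b ≤ dist x y)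
    (u : G) : dist (u • γ a) (u • γ b) = b - a ∧
      IsGeodesicSegment (fun τ => u • γ (a + τ)) (u • γ a) (u • γ b) := by
  have hd : dist (u • γ a) (u • γ b) = b - a := by
    rw [dist_smul, h.isometric a ⟨ha, hab.trans hb⟩ b ⟨ha.trans hab, hb⟩, abs_sub_comm,
      abs_of_nonneg (sub_nonneg.2 hab)]
  refine ⟨hd, ⟨by simp, by simp [hd], fun s hs t ht => ?_⟩⟩
  rw [hd] at hs ht
  rw [dist_smul, h.isometric _ ⟨by linarith [hs.1], by linarith [hs.2]⟩ _
    ⟨by linarith [ht.1], by linarith [ht.2]⟩]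
  congr 1
  ring

theorem one_mem_awaySet {K : Set X} (hK : K.Nonempty) : (1 : G) ∈ awaySet G K := by
  obtain ⟨x, hx⟩ := hK
  refine ⟨x, hx, x, hx, fun _ => x, ⟨rfl, by simp, fun s hs t ht => ?_⟩, ?_⟩
  · simp only [one_smul, dist_self, Icc_self, mem_singleton_iff] at hs ht
    simp [hs, ht]
  · rintro _ ⟨⟨_, _, rfl⟩, _⟩
    exact Or.inl hx

theorem isClosed_iUnion_smul [IsIsometricSMul G X] [ProperSpace X] [ProperlyDiscontinuousSMul G X]
    {K : Set X} (hK : IsCompact K) : IsClosed (⋃ h : G, h • K) := by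
  refine LocallyFinite.isClosed_iUnion (fun x => ?_)
    fun h => (hK.smul h).isClosed
  refine ⟨Metric.closedBall x 1, Metric.closedBall_mem_nhds x one_pos, ?_⟩
  exact ProperlyDiscontinuousSMul.finite_disjoint_inter_image hK (isCompact_closedBall x 1)

variable [IsIsometricSMul G X] [ProperSpace X] [ProperlyDiscontinuousSMul G X]

/-- Cutting a geodesic from `x₀` to `h • x₀` at the last time before `t` and at the first time after
`t` at which it meets `G K` writes `h` as a product `u * v * w` whose middle factor is the
excursion outside `G K` that takes place at time `t`. -/
theorem exists_excursion (hX : IsGeodesicSpace X) (o : X) {K : Set X} (hK : IsCompact K) {R : ℝ}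
    (hR : K ⊆ Metric.closedBall o R) {x₀ : X} (hx₀ : x₀ ∈ K) (h : G) {t : ℝ} (ht0 : 0 ≤ t)
    (ht : t ≤ dist x₀ (h • x₀)) :
    ∃ u v w : G, h = u * v * w ∧ v ∈ awaySet G K ∧
      dist o (u • o) ≤ t + 2 * R ∧
      t - 2 * R ≤ dist o ((u * v) • o) ∧
      dist o (w • o) ≤ dist o (h • o) - t + 4 * R ∧
      dist o (u • o) + dist o (v • o) + dist o (w • o) ≤ dist o (h • o) + 8 * R ∧
      dist o ((u * v) • o) + dist ((u * v) • o) (h • o) ≤ dist o (h • o) + 6 * R := by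
  obtain ⟨γ, hγ⟩ := hX x₀ (h • x₀)
  set ℓ := dist x₀ (h • x₀) with hℓ
  set Y : Set X := ⋃ g : G, g • K with hY
  have hYc : IsClosed Y := isClosed_iUnion_smul hK
  have hT : IsClosed (Icc 0 ℓ ∩ γ ⁻¹' Y) :=
    hγ.continuousOn.preimage_isClosed_of_isClosed isClosed_Icc hYc
  have hTc : IsCompact (Icc 0 ℓ ∩ γ ⁻¹' Y) :=
    isCompact_Icc.of_isClosed_subset hT inter_subset_left
  have hℓ0 : 0 ≤ ℓ := dist_nonneg
  have h0Y : γ 0 ∈ Y := by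
    rw [hγ.source]; exact mem_iUnion.2 ⟨1, by simpa using hx₀⟩
  have hℓY : γ ℓ ∈ Y := by
    rw [hγ.target]; exact mem_iUnion.2 ⟨h, smul_mem_smul_set hx₀⟩
  obtain ⟨a, ⟨⟨⟨ha0, haℓ⟩, haY⟩, hat⟩, hamax⟩ :=
    (hTc.inter_right (isClosed_Iic (a := t))).exists_isGreatest
      ⟨0, ⟨⟨le_rfl, hℓ0⟩, h0Y⟩, ht0⟩
  obtain ⟨b, ⟨⟨⟨hb0, hbℓ⟩, hbY⟩, htb⟩, hbmin⟩ :=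
    (hTc.inter_right (isClosed_Ici (a := t))).exists_isLeast
      ⟨ℓ, ⟨⟨hℓ0, le_rfl⟩, hℓY⟩, ht⟩
  have hat : a ≤ t := hat
  have htb : t ≤ b := htb
  have hab : a ≤ b := hat.trans htb
  obtain ⟨u, hu⟩ := mem_iUnion.1 haY
  obtain ⟨g, hg⟩ := mem_iUnion.1 hbY
  obtain ⟨hd, hseg⟩ := hγ.translate_subsegment ha0 hab hbℓ u⁻¹
  have hux : u⁻¹ • γ a ∈ K := by rwa [← mem_smul_set_iff_inv_smul_mem]
  have hgy : g⁻¹ • γ b ∈ K := by rwa [← mem_smul_set_iff_inv_smul_mem]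
  have hvy : (u⁻¹ * g) • g⁻¹ • γ b = u⁻¹ • γ b := by rw [mul_smul, smul_inv_smul]
  have hv : u⁻¹ * g ∈ awaySet G K := by
    refine ⟨u⁻¹ • γ a, hux, g⁻¹ • γ b, hgy, fun τ => u⁻¹ • γ (a + τ), ?_, ?_⟩
    · rw [hvy]; exact hseg
    · -- by the choice of `a` and `b`, the piece meets `G K` at its end points only
      rw [hvy, hd]
      rintro _ ⟨⟨τ, ⟨hτ0, hτ1⟩, rfl⟩, hp⟩
      obtain ⟨k, hk⟩ := mem_iUnion.1 hp
      have hτY : γ (a + τ) ∈ Y := by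
        refine mem_iUnion.2 ⟨u * k, ?_⟩
        rw [mul_smul, mem_smul_set_iff_inv_smul_mem]
        exact hk
      have hmem : a + τ ∈ Icc 0 ℓ ∩ γ ⁻¹' Y := ⟨⟨by linarith, by linarith⟩, hτY⟩
      rcases le_total (a + τ) t with hle | hle
      · have := hamax ⟨hmem, hle⟩
        obtain rfl : τ = 0 := by linarith
        left
        simpa using hux
      · have := hbmin ⟨hmem, hle⟩
        have hb' : a + τ = b := by linarith
        right
        simp only [hb']
        rw [← hvy]
        exact smul_mem_smul_set hgy
  -- a point of `k • K` is at distance at most `R` from `k • o`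
  have hclose : ∀ (k : G) (p : X), k⁻¹ • p ∈ K → dist p (k • o) ≤ R := by
    intro k p hp
    have := hR hp
    rwa [Metric.mem_closedBall, ← dist_smul k, smul_inv_smul] at this
  have e1 : dist (γ a) (u • o) ≤ R := hclose u _ hux
  have e2 : dist (γ b) (g • o) ≤ R := hclose g _ hgy
  have e3 : dist (γ 0) o ≤ R := by rw [hγ.source]; exact hR hx₀
  have e4 : dist (γ ℓ) (h • o) ≤ R := by
    refine hclose h _ ?_
    rw [hγ.target, inv_smul_smul]; exact hx₀
  have hseg' : ∀ p ∈ Icc 0 ℓ, ∀ q ∈ Icc 0 ℓ, p ≤ q → dist (γ p) (γ q) = q - p := by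
    intro p hp q hq hpq
    rw [hγ.isometric p hp q hq, abs_sub_comm, abs_of_nonneg (sub_nonneg.2 hpq)]
  have m0 : (0 : ℝ) ∈ Icc 0 ℓ := ⟨le_rfl, hℓ0⟩
  have mℓ : ℓ ∈ Icc 0 ℓ := ⟨hℓ0, le_rfl⟩
  have d1 := hseg' 0 m0 a ⟨ha0, haℓ⟩ ha0
  have d2 := hseg' a ⟨ha0, haℓ⟩ b ⟨hb0, hbℓ⟩ hab
  have d3 := hseg' b ⟨hb0, hbℓ⟩ ℓ mℓ hbℓ
  have d4 := hseg' 0 m0 ℓ mℓ hℓ0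
  have d5 := hseg' 0 m0 b ⟨hb0, hbℓ⟩ hb0
  have hquad : ∀ p q p' q' : X, dist p q ≤ dist p' p + dist p' q' + dist q' q := by
    intro p q p' q'
    rw [dist_comm p' p]
    exact dist_triangle4 p p' q' q
  have c1 := hquad o (u • o) (γ 0) (γ a)
  have c2 := hquad (u • o) (g • o) (γ a) (γ b)
  have c3 := hquad (g • o) (h • o) (γ b) (γ ℓ)
  have c4 := hquad (γ 0) (γ ℓ) o (h • o)
  rw [dist_comm o (γ 0), dist_comm (h • o)] at c4
  have c5 := hquad o (g • o) (γ 0) (γ b)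
  have c6 := hquad (γ 0) (γ b) o (g • o)
  rw [dist_comm o (γ 0), dist_comm (g • o) (γ b)] at c6
  have hvd : dist o ((u⁻¹ * g) • o) = dist (u • o) (g • o) := by
    rw [← dist_smul u o, mul_smul, smul_inv_smul]
  have hwd : dist o ((g⁻¹ * h) • o) = dist (g • o) (h • o) := by
    rw [← dist_smul g o, mul_smul, smul_inv_smul]
  refine ⟨u, u⁻¹ * g, g⁻¹ * h, by group, hv, ?_, ?_, ?_, ?_, ?_⟩
  · linarith
  · rw [mul_inv_cancel_left]; linarith
  · rw [hwd]; linarith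
  · rw [hvd, hwd]; linarith
  · rw [mul_inv_cancel_left]; linarith

end Excursion

/-! ### Finiteness of the growth rate and divergence -/

section Divergence

variable {G X : Type*} [Group G] [MetricSpace X] [MulAction G X]

/-- A Fekete-type bound: if the truncated Poincaré series `F` at exponent `σ` satisfies
`F (t + t') ≤ A * F (t + D) * F (t' + D)`, then a single good value of `F` bounds the growth
rate of the group. -/
theorem groupGrowthRate_le_of_submultiplicative (o : X) {σ s D t₀ : ℝ} {A : ℝ≥0∞} (hσ : 0 ≤ σ)
    (hσs : σ ≤ s) (hD : 0 ≤ D) (ht₀ : 0 < t₀) (hA : 1 ≤ A)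
    (hsub : ∀ t t' : ℝ, 0 ≤ t → 0 ≤ t' → poincareSeries o σ (orbitBall G o (t + t')) ≤
      A * (poincareSeries o σ (orbitBall G o (t + D)) *
        poincareSeries o σ (orbitBall G o (t' + D))))
    (h : A * poincareSeries o σ (orbitBall G o (t₀ + 2 * D)) ≤
      ENNReal.ofReal (Real.exp ((s - σ) * t₀))) : groupGrowthRate G o ≤ s := by
  set H : ℝ → ℝ≥0∞ := fun t => A * poincareSeries o σ (orbitBall G o (t + 2 * D)) with hH
  have hmul : ∀ t t' : ℝ, 0 ≤ t → 0 ≤ t' → H (t + t') ≤ H t * H t' := by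
    intro t t' ht ht'
    have := mul_le_mul_right (hsub (t + D) (t' + D) (by linarith) (by linarith)) A
    simp only [hH]
    convert this using 1
    · congr 3; ring
    · rw [show t + D + D = t + 2 * D by ring, show t' + D + D = t' + 2 * D by ring]; ring
  have hpow : ∀ n : ℕ, H ((n + 1 : ℕ) * t₀) ≤ H t₀ ^ (n + 1) := by
    intro n
    induction n with
    | zero => simp
    | succ n ih =>
      rw [show ((n + 1 + 1 : ℕ) : ℝ) * t₀ = (n + 1 : ℕ) * t₀ + t₀ by push_cast; ring, pow_succ]
      exact (hmul _ _ (by positivity) ht₀.le).trans (mul_le_mul_left ih _)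
  refine groupGrowthRate_le_of_encard_le o (C := 2 * s * t₀) fun ℓ hℓ => ?_
  set n := ⌈ℓ / t₀⌉₊ with hn
  set m : ℝ := (n + 1 : ℕ) * t₀ with hm
  have hn1 : ℓ / t₀ ≤ n := Nat.le_ceil _
  have hn2 : (n : ℝ) < ℓ / t₀ + 1 := Nat.ceil_lt_add_one (by positivity)
  have hm1 : ℓ ≤ m := by
    rw [div_le_iff₀ ht₀] at hn1
    rw [hm]; push_cast; linarith
  have hm2 : m ≤ ℓ + 2 * t₀ := by
    have := mul_lt_mul_of_pos_right hn2 ht₀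
    rw [add_mul, div_mul_cancel₀ _ ht₀.ne'] at this
    rw [hm]; push_cast; linarith
  have hball : ∀ {a b : ℝ}, a ≤ b → orbitBall G o a ⊆ orbitBall G o b :=
    fun hab g hg => le_trans (show dist o (g • o) ≤ _ from hg) hab
  calc (((orbitBall G o ℓ).encard : ℕ∞) : ℝ≥0∞)
      ≤ (((orbitBall G o m).encard : ℕ∞) : ℝ≥0∞) := by
        have := encard_le_encard (hball hm1)
        exact_mod_cast this
    _ ≤ ENNReal.ofReal (Real.exp (σ * m)) * poincareSeries o σ (orbitBall G o m) :=
        encard_orbitBall_le o hσ m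
    _ ≤ ENNReal.ofReal (Real.exp (σ * m)) * H m := by
        refine mul_le_mul_right ?_ _
        exact (poincareSeries_mono_set o σ (hball (by linarith))).trans (le_mul_of_one_le_left' hA)
    _ ≤ ENNReal.ofReal (Real.exp (σ * m)) *
          ENNReal.ofReal (Real.exp ((s - σ) * t₀)) ^ (n + 1) := by
        refine mul_le_mul_right ((hpow n).trans ?_) _
        exact pow_le_pow_left' h _
    _ = ENNReal.ofReal (Real.exp (s * m)) := by
        rw [← ENNReal.ofReal_pow (by positivity), ← Real.exp_nat_mul,
          ← ENNReal.ofReal_mul (by positivity), ← Real.exp_add]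
        congr 2
        rw [hm]; ring
    _ ≤ ENNReal.ofReal (Real.exp (s * ℓ + 2 * s * t₀)) := by
        refine ENNReal.ofReal_le_ofReal (Real.exp_le_exp.2 ?_)
        have := mul_le_mul_of_nonneg_left hm2 (hσ.trans hσs)
        linarith

/-- If the Poincaré series converges at `ω`, then its truncation at a smaller exponent `σ` grows
more slowly than `exp ((ω - σ) * t)`. -/
theorem tendsto_exp_mul_poincareSeries_orbitBall (o : X) {σ ω : ℝ} (hσω : σ < ω) (D : ℝ)
    (h : poincareSeries o ω (univ : Set G) ≠ ⊤) :
    Tendsto (fun t : ℝ => ENNReal.ofReal (Real.exp (-(ω - σ) * t)) *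
      poincareSeries o σ (orbitBall G o (t + D))) atTop (𝓝 0) := by
  rw [poincareSeries_univ] at h
  have hsum : Summable fun g : G => Real.exp (-ω * dist o (g • o)) := by
    have := ENNReal.summable_toReal h
    simpa [ENNReal.toReal_ofReal, (Real.exp_pos _).le] using this
  set f : ℝ → G → ℝ := fun t => (orbitBall G o (t + D)).indicator
    fun g => Real.exp (-(ω - σ) * t) * Real.exp (-σ * dist o (g • o)) with hf
  have hf0 : ∀ t g, 0 ≤ f t g := fun t g => indicator_nonneg (fun g _ => by positivity) g
  have hfle : ∀ t g, f t g ≤ Real.exp ((ω - σ) * D) * Real.exp (-ω * dist o (g • o)) := by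
    intro t g
    by_cases hg : g ∈ orbitBall G o (t + D)
    swap
    · simp only [hf, indicator_of_notMem hg]
      positivity
    simp only [hf, indicator_of_mem hg]
    rw [← Real.exp_add, ← Real.exp_add, Real.exp_le_exp]
    have := mul_le_mul_of_nonneg_left (show dist o (g • o) ≤ t + D from hg) (sub_nonneg.2 hσω.le)
    linarith
  have hlim : ∀ g, Tendsto (fun t => f t g) atTop (𝓝 0) := by
    intro g
    have h1 : Tendsto (fun t : ℝ => Real.exp (-(ω - σ) * t) * Real.exp (-σ * dist o (g • o)))
        atTop (𝓝 0) := by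
      rw [← zero_mul (Real.exp (-σ * dist o (g • o)))]
      refine (Real.tendsto_exp_atBot.comp ?_).mul_const _
      exact tendsto_id.const_mul_atTop_of_neg (by linarith)
    refine squeeze_zero (fun t => hf0 t g) (fun t => ?_) h1
    exact indicator_le_self' (fun g _ => by positivity) g
  have hdom := tendsto_tsum_of_dominated_convergence (hsum.mul_left (Real.exp ((ω - σ) * D)))
    hlim (Eventually.of_forall fun t g => by
      rw [Real.norm_of_nonneg (hf0 t g)]; exact hfle t g)
  rw [tsum_zero] at hdom
  have := ENNReal.tendsto_ofReal hdom
  rw [ENNReal.ofReal_zero] at this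
  refine this.congr fun t => ?_
  rw [ENNReal.ofReal_tsum_of_nonneg (hf0 t)
    (.of_nonneg_of_le (hf0 t) (hfle t) (hsum.mul_left _)), poincareSeries, ← ENNReal.tsum_mul_left,
    tsum_subtype (orbitBall G o (t + D)) (fun g : G => ENNReal.ofReal (Real.exp (-(ω - σ) * t)) *
      ENNReal.ofReal (Real.exp (-σ * dist o (g • o))))]
  refine tsum_congr fun g => ?_
  by_cases hg : g ∈ orbitBall G o (t + D)
  · simp only [hf, indicator_of_mem hg]
    rw [ENNReal.ofReal_mul (by positivity)]
  · simp only [hf, indicator_of_notMem hg, ENNReal.ofReal_zero]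

variable [IsIsometricSMul G X] [ProperSpace X] [ProperlyDiscontinuousSMul G X]

/-- Submultiplicativity of the truncated Poincaré series: cut a geodesic at time `t`; the
excursion outside `G K` that takes place there costs a factor `poincareSeries o σ (G_K)`. -/
theorem poincareSeries_orbitBall_add_le (hX : IsGeodesicSpace X) (o : X) {K : Set X}
    (hK : IsCompact K) (hKne : K.Nonempty) {R : ℝ} (hR0 : 0 ≤ R)
    (hR : K ⊆ Metric.closedBall o R) {σ : ℝ} (hσ : 0 ≤ σ) {t t' : ℝ} (ht : 0 ≤ t) (ht' : 0 ≤ t') :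
    poincareSeries o σ (orbitBall G o (t + t')) ≤
      ENNReal.ofReal (Real.exp (σ * (8 * R))) * poincareSeries o σ (awaySet G K) *
      (poincareSeries o σ (orbitBall G o (t + 6 * R)) *
        poincareSeries o σ (orbitBall G o (t' + 6 * R))) := by
  obtain ⟨x₀, hx₀⟩ := hKne
  have := poincareSeries_le_mul o hσ (8 * R) (A := orbitBall G o (t + t'))
    (U := orbitBall G o (t + 6 * R)) (V := awaySet G K) (W := orbitBall G o (t' + 6 * R)) ?_
  · refine this.trans (le_of_eq ?_)
    ring
  intro h hh
  have hh : dist o (h • o) ≤ t + t' := hh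
  have e1 : dist o x₀ ≤ R := by rw [dist_comm]; exact hR hx₀
  have e2 : dist (h • x₀) (h • o) ≤ R := by rw [dist_smul]; exact hR hx₀
  have e3 := dist_triangle4 o x₀ (h • x₀) (h • o)
  rcases le_total t (dist x₀ (h • x₀)) with hle | hle
  · obtain ⟨u, v, w, rfl, hv, hu, -, hw, hd, -⟩ := exists_excursion hX o hK hR hx₀ h ht hle
    exact ⟨u, by simp only [orbitBall, mem_ofPred_eq]; linarith, v, hv, w,
      by simp only [orbitBall, mem_ofPred_eq]; linarith, rfl, hd⟩
  · obtain ⟨u, v, w, rfl, hv, hu, -, hw, hd, -⟩ :=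
      exists_excursion hX o hK hR hx₀ h dist_nonneg le_rfl
    exact ⟨u, by simp only [orbitBall, mem_ofPred_eq]; linarith, v, hv, w,
      by simp only [orbitBall, mem_ofPred_eq]; linarith, rfl, hd⟩

/-- If the growth rate of `G_K` is smaller than that of `G`, then the latter is finite and the
Poincaré series diverges there. -/
theorem exists_groupGrowthRate_eq_and_poincareSeries_eq_top (hX : IsGeodesicSpace X) (o : X)
    {K : Set X} (hK : IsCompact K) (hKne : K.Nonempty)
    (h : growthRate (awaySet G K) o < groupGrowthRate G o) :
    ∃ σ ω : ℝ, 0 < σ ∧ σ < ω ∧ (ω : EReal) = groupGrowthRate G o ∧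
      poincareSeries o σ (awaySet G K) < ⊤ ∧ poincareSeries o ω (univ : Set G) = ⊤ := by
  obtain ⟨R₀, hR₀⟩ := hK.isBounded.subset_closedBall o
  set R := max R₀ 0 with hRdef
  have hR0 : 0 ≤ R := le_max_right _ _
  have hR : K ⊆ Metric.closedBall o R :=
    hR₀.trans (Metric.closedBall_subset_closedBall (le_max_left _ _))
  obtain ⟨σ, hσ1, hσ2⟩ := EReal.exists_between_coe_real h
  have hσ : 0 < σ := by exact_mod_cast (growthRate_nonneg (one_mem_awaySet hKne) o).trans_lt hσ1
  have hQ : poincareSeries o σ (awaySet G K) < ⊤ :=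
    poincareSeries_lt_top_of_growthRate_lt hσ hσ1
  set A := ENNReal.ofReal (Real.exp (σ * (8 * R))) * poincareSeries o σ (awaySet G K) with hA
  have hA1 : 1 ≤ A := by
    refine one_le_mul ?_ (one_le_poincareSeries o σ (one_mem_awaySet hKne))
    rw [ENNReal.one_le_ofReal, Real.one_le_exp_iff]
    positivity
  have hAtop : A ≠ ⊤ := (ENNReal.mul_lt_top ENNReal.ofReal_lt_top hQ).ne
  have hFtop : ∀ t, A * poincareSeries o σ (orbitBall G o t) ≠ ⊤ := fun t =>
    ENNReal.mul_ne_top hAtop (poincareSeries_lt_top_of_finite o σ (finite_orbitBall G o t)).ne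
  have hfek : ∀ (s t₀ : ℝ), σ ≤ s → 0 < t₀ →
      A * poincareSeries o σ (orbitBall G o (t₀ + 2 * (6 * R))) ≤
        ENNReal.ofReal (Real.exp ((s - σ) * t₀)) → groupGrowthRate G o ≤ s := fun s t₀ hs ht₀ =>
    groupGrowthRate_le_of_submultiplicative o hσ.le hs (by positivity) ht₀ hA1
      fun t t' ht ht' => poincareSeries_orbitBall_add_le hX o hK hKne hR0 hR hσ.le ht ht'
  -- the hypothesis of `hfek` holds for `t₀ = 1` and large `s`
  have hfin : groupGrowthRate G o ≠ ⊤ := by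
    set M := A * poincareSeries o σ (orbitBall G o (1 + 2 * (6 * R))) with hM
    have : groupGrowthRate G o ≤ ((σ + M.toReal : ℝ) : EReal) := by
      refine hfek _ 1 (by simp) one_pos ?_
      rw [ENNReal.le_ofReal_iff_toReal_le (hFtop _) (by positivity)]
      have := Real.add_one_le_exp ((σ + M.toReal - σ) * 1)
      linarith
    exact (this.trans_lt (EReal.coe_lt_top _)).ne
  have hω : ((groupGrowthRate G o).toReal : EReal) = groupGrowthRate G o :=
    EReal.coe_toReal hfin (hσ2.trans_le' bot_le).ne'
  set ω := (groupGrowthRate G o).toReal with hωdef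
  have hσω : σ < ω := by rw [← hω] at hσ2; exact_mod_cast hσ2
  refine ⟨σ, ω, hσ, hσω, hω, hQ, ?_⟩
  -- convergence at `ω` would give the hypothesis of `hfek` for some `t₀` and some `s < ω`
  by_contra htop
  have hlim := ENNReal.Tendsto.const_mul
    (tendsto_exp_mul_poincareSeries_orbitBall o hσω (2 * (6 * R)) htop) (Or.inr hAtop)
  rw [mul_zero] at hlim
  obtain ⟨t₀, h1, ht₀⟩ := ((hlim.eventually_lt_const one_pos).and (eventually_gt_atTop 0)).exists
  set M := A * poincareSeries o σ (orbitBall G o (t₀ + 2 * (6 * R))) with hM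
  have hMlt : M.toReal < Real.exp ((ω - σ) * t₀) := by
    rw [← ENNReal.toReal_ofReal (Real.exp_pos ((ω - σ) * t₀)).le]
    refine (ENNReal.toReal_lt_toReal (hFtop _) ENNReal.ofReal_ne_top).2 ?_
    have h2 : ENNReal.ofReal (Real.exp (-(ω - σ) * t₀)) * M < 1 := by
      rw [hM]; convert h1 using 1; ring
    calc M = ENNReal.ofReal (Real.exp ((ω - σ) * t₀)) *
          (ENNReal.ofReal (Real.exp (-(ω - σ) * t₀)) * M) := by
          rw [← mul_assoc, ← ENNReal.ofReal_mul (by positivity), ← Real.exp_add, neg_mul,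
            add_neg_cancel, Real.exp_zero, ENNReal.ofReal_one, one_mul]
      _ < ENNReal.ofReal (Real.exp ((ω - σ) * t₀)) * 1 := by
          refine ENNReal.mul_lt_mul_right ?_ ENNReal.ofReal_ne_top h2
          simpa using Real.exp_pos _
      _ = _ := mul_one _
  have hcont : Tendsto (fun s : ℝ => Real.exp ((s - σ) * t₀)) (𝓝[<] ω)
      (𝓝 (Real.exp ((ω - σ) * t₀))) := by
    refine Tendsto.mono_left (Continuous.tendsto ?_ ω) nhdsWithin_le_nhds
    fun_prop
  obtain ⟨s, ⟨hs1, hs2⟩, hs3⟩ := (((hcont.eventually_const_lt hMlt).and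
    (nhdsWithin_le_nhds (eventually_gt_nhds hσω))).and self_mem_nhdsWithin).exists
  have := hfek s t₀ hs2.le ht₀ (by
    rw [ENNReal.le_ofReal_iff_toReal_le (hFtop _) (by positivity)]
    exact hs1.le)
  rw [← hω] at this
  exact absurd (show ω ≤ s by exact_mod_cast this) (not_le.2 hs3)

end Divergence

/-! ### Compactness of the horocompactification -/

section Compactness

variable {X : Type*} [MetricSpace X]

/-- A continuous cocycle as a continuous function on `X × X`. -/
def ContinuousCocycle.toContinuousMap {X : Type*} [TopologicalSpace X] (c : ContinuousCocycle X) :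
    C(X × X, ℝ) := c.1

theorem ContinuousCocycle.isEmbedding_toContinuousMap (X : Type*) [TopologicalSpace X] :
    IsEmbedding (toContinuousMap (X := X)) :=
  IsEmbedding.subtypeVal

/-- A point of the horocompactification as a continuous cocycle. -/
def Horocompactification.toCocycle (c : Horocompactification X) : ContinuousCocycle X := c.1

theorem Horocompactification.isEmbedding_toCocycle :
    IsEmbedding (toCocycle (X := X)) :=
  IsEmbedding.subtypeVal

theorem ContinuousCocycle.continuous_apply {X : Type*} [TopologicalSpace X] (p : X × X) :
    Continuous fun c : ContinuousCocycle X => c.toContinuousMap p :=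
  (continuous_eval_const p).comp (isEmbedding_toContinuousMap X).continuous

theorem Horocompactification.continuous_eval (x y : X) :
    Continuous fun c : Horocompactification X => c.eval x y :=
  (ContinuousCocycle.continuous_apply (x, y)).comp isEmbedding_toCocycle.continuous

theorem Horocompactification.eval_add (c : Horocompactification X) (x y z : X) :
    c.eval x y + c.eval y z = c.eval x z :=
  (c.1.2 x y z).symm

theorem Horocompactification.eval_self (c : Horocompactification X) (x : X) : c.eval x x = 0 := by
  have := c.eval_add x x x
  linarith

theorem ContinuousCocycle.abs_apply_le_of_mem_closure {c : ContinuousCocycle X}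
    (hc : c ∈ closure (range (pointCocycle (X := X)))) (x y : X) :
    |c.1 (x, y)| ≤ dist x y := by
  have hcl : IsClosed {c : ContinuousCocycle X | |c.1 (x, y)| ≤ dist x y} :=
    isClosed_le (ContinuousCocycle.continuous_apply (x, y)).abs continuous_const
  refine closure_minimal ?_ hcl hc
  rintro _ ⟨z, rfl⟩
  exact abs_dist_sub_le x y z

theorem Horocompactification.abs_eval_le (c : Horocompactification X) (x y : X) :
    |c.eval x y| ≤ dist x y :=
  ContinuousCocycle.abs_apply_le_of_mem_closure c.2 x y

/-- The cocycles with `|c (x, y)| ≤ dist x y` form a compact set, by the Arzelà–Ascoli theorem: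
such cocycles are uniformly Lipschitz, and the condition is closed for pointwise convergence. -/
theorem isCompact_setOf_cocycle_abs_le (X : Type*) [MetricSpace X] :
    IsCompact {c : C(X × X, ℝ) | (∀ x y z : X, c (x, z) = c (x, y) + c (y, z)) ∧
      ∀ x y : X, |c (x, y)| ≤ dist x y} := by
  set S := {c : C(X × X, ℝ) | (∀ x y z : X, c (x, z) = c (x, y) + c (y, z)) ∧
      ∀ x y : X, |c (x, y)| ≤ dist x y}
  have hlip : ∀ f : X × X → ℝ, (∀ x y z : X, f (x, z) = f (x, y) + f (y, z)) →
      (∀ x y : X, |f (x, y)| ≤ dist x y) → LipschitzWith 2 f := by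
    intro f h1 h2
    refine LipschitzWith.of_dist_le_mul fun p q => ?_
    obtain ⟨x, y⟩ := p
    obtain ⟨x', y'⟩ := q
    have e : f (x, y) - f (x', y') = f (x, x') + f (y', y) := by
      rw [h1 x x' y, h1 x' y' y]; ring
    rw [Real.dist_eq, e]
    have b1 : dist x x' ≤ dist (x, y) (x', y') := le_max_left _ _
    have b2 : dist y y' ≤ dist (x, y) (x', y') := le_max_right _ _
    have := abs_add_le (f (x, x')) (f (y', y))
    have := h2 x x'
    have := h2 y' y
    rw [dist_comm y' y] at this
    rw [NNReal.coe_ofNat]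
    linarith
  refine ArzelaAscoli.isCompact_of_equicontinuous S ?_ ?_
  · have himage : ContinuousMap.toFun '' S =
        (univ.pi fun p : X × X => Icc (-dist p.1 p.2) (dist p.1 p.2)) ∩
          ⋂ (x : X) (y : X) (z : X), {f : X × X → ℝ | f (x, z) = f (x, y) + f (y, z)} := by
      ext f
      constructor
      · rintro ⟨c, ⟨h1, h2⟩, rfl⟩
        refine ⟨fun p _ => abs_le.1 (h2 p.1 p.2), ?_⟩
        simp only [mem_iInter]
        exact h1
      · rintro ⟨h2, h1⟩
        simp only [mem_iInter] at h1
        have h2' : ∀ x y : X, |f (x, y)| ≤ dist x y := fun x y => abs_le.2 (h2 (x, y) trivial)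
        exact ⟨⟨f, (hlip f h1 h2').continuous⟩, ⟨h1, h2'⟩, rfl⟩
    rw [himage]
    refine (isCompact_univ_pi fun _ => isCompact_Icc).inter_right ?_
    refine isClosed_iInter fun x => isClosed_iInter fun y => isClosed_iInter fun z => ?_
    exact isClosed_eq (continuous_apply (x, z)) (by fun_prop)
  · refine Metric.equicontinuous_of_continuity_modulus (fun r => 2 * r) ?_ _ fun p q c => ?_
    · have : Tendsto (fun r : ℝ => 2 * r) (𝓝 0) (𝓝 (2 * 0)) := tendsto_id.const_mul 2
      simpa using this
    · exact (hlip c.1 c.2.1 c.2.2).dist_le_mul p q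

instance Horocompactification.instCompactSpace : CompactSpace (Horocompactification X) := by
  have hS : IsCompact {c : ContinuousCocycle X |
      ∀ x y : X, |c.toContinuousMap (x, y)| ≤ dist x y} := by
    rw [(ContinuousCocycle.isEmbedding_toContinuousMap X).isCompact_iff]
    convert isCompact_setOf_cocycle_abs_le X using 1
    ext c
    constructor
    · rintro ⟨c, hc, rfl⟩
      exact ⟨c.2, hc⟩
    · rintro ⟨h1, h2⟩
      exact ⟨⟨c, h1⟩, h2, rfl⟩
  exact isCompact_iff_compactSpace.1 (hS.of_isClosed_subset isClosed_closure
    fun c hc x y => ContinuousCocycle.abs_apply_le_of_mem_closure hc x y)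

instance Horocompactification.instMetrizableSpace [ProperSpace X] :
    TopologicalSpace.MetrizableSpace (Horocompactification X) :=
  ((ContinuousCocycle.isEmbedding_toContinuousMap X).comp isEmbedding_toCocycle).metrizableSpace

variable {G : Type*} [Group G] [MulAction G X] [IsIsometricSMul G X]

theorem Horocompactification.eval_smul (g : G) (c : Horocompactification X) (x y : X) :
    (g • c).eval x y = c.eval (g⁻¹ • x) (g⁻¹ • y) := rfl

theorem Horocompactification.smul_ofPoint (g : G) (z : X) :
    g • ofPoint z = ofPoint (g • z) :=
  Subtype.ext (ContinuousCocycle.act_pointCocycle g z)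

theorem Horocompactification.eval_ofPoint (x y z : X) :
    (ofPoint z).eval x y = dist x z - dist y z := rfl

end Compactness

/-! ### Orbital measures and their limits -/

section OrbitMeasure

variable {G X : Type*} [Group G] [MetricSpace X] [MulAction G X]

variable (G) in
/-- The normalized weighted orbital measure
`(∑ g, exp (-s * dist o (g • o)))⁻¹ * ∑ g, exp (-s * dist o (g • o)) • δ_(g • o)`
on the horocompactification. -/
def orbitMeasure (o : X) (s : ℝ) : Measure (Horocompactification X) :=
  (poincareSeries o s (univ : Set G))⁻¹ • Measure.sum fun g : G =>
    ENNReal.ofReal (Real.exp (-s * dist o (g • o))) •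
      Measure.dirac (Horocompactification.ofPoint (g • o))

theorem lintegral_orbitMeasure (o : X) (s : ℝ) {f : Horocompactification X → ℝ≥0∞}
    (hf : Measurable f) : ∫⁻ c, f c ∂(orbitMeasure G o s) =
      (poincareSeries o s (univ : Set G))⁻¹ * ∑' g : G,
        ENNReal.ofReal (Real.exp (-s * dist o (g • o))) *
          f (Horocompactification.ofPoint (g • o)) := by
  rw [orbitMeasure, lintegral_smul_measure, lintegral_sum_measure, smul_eq_mul]
  simp_rw [lintegral_smul_measure, lintegral_dirac' _ hf, smul_eq_mul]

theorem orbitMeasure_apply (o : X) (s : ℝ) {A : Set (Horocompactification X)}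
    (hA : MeasurableSet A) : orbitMeasure G o s A = (poincareSeries o s (univ : Set G))⁻¹ *
      poincareSeries o s {g : G | Horocompactification.ofPoint (g • o) ∈ A} := by
  rw [← lintegral_indicator_one hA, lintegral_orbitMeasure o s (measurable_one.indicator hA),
    poincareSeries, poincareSeries,
    tsum_subtype {g : G | Horocompactification.ofPoint (g • o) ∈ A}
      (fun g : G => ENNReal.ofReal (Real.exp (-s * dist o (g • o))))]
  congr 1
  refine tsum_congr fun g => ?_
  by_cases hg : Horocompactification.ofPoint (g • o) ∈ A
  · rw [indicator_of_mem hg, indicator_of_mem (by exact hg)]; simp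
  · rw [indicator_of_notMem hg, indicator_of_notMem (by exact hg)]; simp

theorem isProbabilityMeasure_orbitMeasure (o : X) {s : ℝ}
    (h : poincareSeries o s (univ : Set G) < ⊤) : IsProbabilityMeasure (orbitMeasure G o s) := by
  refine ⟨?_⟩
  rw [orbitMeasure_apply o s MeasurableSet.univ]
  simp only [mem_univ, ofPred_true]
  exact ENNReal.inv_mul_cancel
    (one_pos.trans_le (one_le_poincareSeries o s (mem_univ (1 : G)))).ne' h.ne

variable [IsIsometricSMul G X]

/-- The weighted orbital measures are quasi-invariant, with the expected density. -/
theorem lintegral_smul_orbitMeasure (o : X) (s : ℝ) (g : G) {f : Horocompactification X → ℝ≥0∞}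
    (hf : Measurable f) : ∫⁻ c, f (g • c) ∂(orbitMeasure G o s) =
      ∫⁻ c, f c * ENNReal.ofReal (Real.exp (-s * c.eval (g • o) o)) ∂(orbitMeasure G o s) := by
  have hm : Measurable fun c : Horocompactification X =>
      ENNReal.ofReal (Real.exp (-s * c.eval (g • o) o)) :=
    (ENNReal.continuous_ofReal.comp (Real.continuous_exp.comp
      ((Horocompactification.continuous_eval _ _).const_mul _))).measurable
  rw [lintegral_orbitMeasure o s (f := fun c => f (g • c))
    (hf.comp (continuous_const_smul g).measurable), lintegral_orbitMeasure o s
      (f := fun c => f c * ENNReal.ofReal (Real.exp (-s * c.eval (g • o) o))) (hf.mul hm)]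
  congr 1
  refine (tsum_congr fun h => ?_).trans ((Equiv.mulLeft g).tsum_eq _)
  rw [Equiv.coe_mulLeft, Horocompactification.smul_ofPoint, mul_comm (f _),
    ← mul_assoc, ← ENNReal.ofReal_mul (by positivity), ← Real.exp_add, mul_smul,
    Horocompactification.eval_ofPoint, dist_smul]
  congr 3
  ring

/-- A weak limit of the weighted orbital measures as the exponent tends to `ω` is quasi-invariant,
and the mass it gives to an open set is controlled by that of the approximating measures. -/
theorem exists_limit_orbitMeasure [ProperSpace X] (o : X) {ω : ℝ} {s : ℕ → ℝ} (hs : ∀ n, ω ≤ s n)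
    (hlim : Tendsto s atTop (𝓝 ω)) (hP : ∀ n, poincareSeries o (s n) (univ : Set G) < ⊤) :
    ∃ ν : Measure (Horocompactification X), IsProbabilityMeasure ν ∧
      (∀ g : G, ν.map (fun c => g • c) =
        ν.withDensity fun c => ENNReal.ofReal (Real.exp (-ω * c.eval (g • o) o))) ∧
      ∀ U, IsOpen U → ν U ≤ limsup (fun n => orbitMeasure G o (s n) U) atTop := by
  let μ : ℕ → ProbabilityMeasure (Horocompactification X) := fun n =>
    ⟨orbitMeasure G o (s n), isProbabilityMeasure_orbitMeasure o (hP n)⟩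
  let 𝒰 : Ultrafilter ℕ := Ultrafilter.of atTop
  have h𝒰 : (𝒰 : Filter ℕ) ≤ atTop := Ultrafilter.of_le _
  let ν := (𝒰.map μ).lim
  have hν : Tendsto μ 𝒰 (𝓝 ν) := (𝒰.map μ).le_nhds_lim
  have hs𝒰 : Tendsto s 𝒰 (𝓝 ω) := hlim.mono_left h𝒰
  refine ⟨ν, inferInstance, fun g => ?_, fun U hU => ?_⟩
  swap
  · refine (ProbabilityMeasure.le_liminf_measure_open_of_tendsto hν hU).trans ?_
    exact (liminf_le_limsup).trans (limsup_le_limsup_of_le h𝒰)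
  have hcont : ∀ t : ℝ, Continuous fun c : Horocompactification X =>
      Real.exp (-t * c.eval (g • o) o) := fun t =>
    Real.continuous_exp.comp ((Horocompactification.continuous_eval _ _).const_mul _)
  have hmeas : ∀ t : ℝ, Measurable fun c : Horocompactification X =>
      ENNReal.ofReal (Real.exp (-t * c.eval (g • o) o)) := fun t =>
    (ENNReal.continuous_ofReal.comp (hcont t)).measurable
  have hg : Measurable fun c : Horocompactification X => g • c :=
    (continuous_const_smul g).measurable
  set d := dist (g • o) o with hd
  have hfinite : IsFiniteMeasure ((ν : Measure (Horocompactification X)).withDensity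
      fun c => ENNReal.ofReal (Real.exp (-ω * c.eval (g • o) o))) := by
    refine isFiniteMeasure_withDensity_ofReal ?_
    exact ((BoundedContinuousFunction.mkOfCompact ⟨_, hcont ω⟩).integrable _).2
  have : IsFiniteMeasure ((ν : Measure (Horocompactification X)).map fun c => g • c) :=
    Measure.isFiniteMeasure_map _ _
  refine ext_of_forall_lintegral_eq_of_IsFiniteMeasure fun f => ?_
  have hfm : Measurable fun c => (f c : ℝ≥0∞) := by
    exact (ENNReal.continuous_coe.comp f.continuous).measurable
  rw [lintegral_map hfm hg, lintegral_withDensity_eq_lintegral_mul _ (hmeas ω) hfm]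
  simp only [Pi.mul_apply]
  have hconv := (ProbabilityMeasure.tendsto_iff_forall_lintegral_tendsto).1 hν
  have h1 := hconv (BoundedContinuousFunction.mkOfCompact
    ⟨fun c => f (g • c), f.continuous.comp (continuous_const_smul g)⟩)
  have h2 := hconv (BoundedContinuousFunction.mkOfCompact
    ⟨fun c => Real.toNNReal (Real.exp (-ω * c.eval (g • o) o)) * f c,
      (continuous_real_toNNReal.comp (hcont ω)).mul f.continuous⟩)
  simp only [BoundedContinuousFunction.mkOfCompact_apply, ContinuousMap.coe_mk,
    ENNReal.coe_mul] at h1 h2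
  refine tendsto_nhds_unique h1 ?_
  -- these factors, which compare the exponents `s n` and `ω` whatever `c` is, tend to `1`
  have hfac : ∀ ε : ℝ, Tendsto (fun n => ENNReal.ofReal (Real.exp (ε * ((s n - ω) * d)))) 𝒰
      (𝓝 1) := by
    intro ε
    have : Tendsto (fun n => Real.exp (ε * ((s n - ω) * d))) 𝒰
        (𝓝 (Real.exp (ε * ((ω - ω) * d)))) :=
      (Real.continuous_exp.tendsto _).comp (((hs𝒰.sub_const ω).mul_const d).const_mul ε)
    have := ENNReal.tendsto_ofReal this
    simpa using this
  have hlow := ENNReal.Tendsto.mul (hfac (-1)) (Or.inl one_ne_zero) h2 (Or.inr ENNReal.one_ne_top)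
  have hupp := ENNReal.Tendsto.mul (hfac 1) (Or.inl one_ne_zero) h2 (Or.inr ENNReal.one_ne_top)
  rw [one_mul] at hlow hupp
  have habs : ∀ (n : ℕ) (c : Horocompactification X),
      |(s n - ω) * c.eval (g • o) o| ≤ (s n - ω) * d := by
    intro n c
    rw [abs_mul, abs_of_nonneg (sub_nonneg.2 (hs n))]
    exact mul_le_mul_of_nonneg_left (c.abs_eval_le _ _) (sub_nonneg.2 (hs n))
  have hJ : ∀ (n : ℕ) (a : ℝ), ENNReal.ofReal (Real.exp a) *
      ∫⁻ c, ENNReal.ofReal (Real.exp (-ω * c.eval (g • o) o)) * f c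
        ∂(μ n : Measure (Horocompactification X)) =
      ∫⁻ c, ENNReal.ofReal (Real.exp (a + -ω * c.eval (g • o) o)) * f c
        ∂(μ n : Measure (Horocompactification X)) := by
    intro n a
    refine (lintegral_const_mul _ ((hmeas ω).mul hfm)).symm.trans (lintegral_congr fun c => ?_)
    rw [Pi.mul_apply, ← mul_assoc, ← ENNReal.ofReal_mul (by positivity), ← Real.exp_add]
  have hI : ∀ n, ∫⁻ c, f (g • c) ∂(μ n : Measure (Horocompactification X)) =
      ∫⁻ c, ENNReal.ofReal (Real.exp (-(s n) * c.eval (g • o) o)) * f c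
        ∂(μ n : Measure (Horocompactification X)) := by
    intro n
    refine (lintegral_smul_orbitMeasure o (s n) g hfm).trans ?_
    exact lintegral_congr fun c => mul_comm _ _
  refine tendsto_of_tendsto_of_tendsto_of_le_of_le hlow hupp (fun n => ?_) (fun n => ?_)
  · rw [hI]
    refine (hJ n _).trans_le (lintegral_mono fun c => ?_)
    refine mul_le_mul_left (ENNReal.ofReal_le_ofReal (Real.exp_le_exp.2 ?_)) _
    linarith [(abs_le.1 (habs n c)).2]
  · rw [hI]
    refine (lintegral_mono fun c => ?_).trans_eq (hJ n _).symm
    refine mul_le_mul_left (ENNReal.ofReal_le_ofReal (Real.exp_le_exp.2 ?_)) _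
    linarith [(abs_le.1 (habs n c)).1]

end OrbitMeasure

/-! ### Full measure of the radial limit set -/

section RadialLimitSet

variable {G X : Type*} [Group G] [MetricSpace X] [MulAction G X]

variable (G) in
/-- The points of the horocompactification that lie in none of the shadows `shadow o (g • o) r` of
the orbit points with `T₀ ≤ dist o (g • o) ≤ T₁`. -/
def outsideShadows (o : X) (r T₀ T₁ : ℝ) : Set (Horocompactification X) :=
  {c | ∀ g : G, T₀ ≤ dist o (g • o) → dist o (g • o) ≤ T₁ → c ∉ shadow o (g • o) r}

theorem isOpen_outsideShadows [ProperSpace X] [ProperlyDiscontinuousSMul G X] (o : X)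
    (r T₀ T₁ : ℝ) : IsOpen (outsideShadows G o r T₀ T₁) := by
  have : outsideShadows G o r T₀ T₁ =
      ⋂ g ∈ orbitBall G o T₁ ∩ {g | T₀ ≤ dist o (g • o)}, (shadow o (g • o) r)ᶜ := by
    ext c
    simp only [outsideShadows, orbitBall, mem_ofPred_eq, mem_iInter, mem_inter_iff, mem_compl_iff,
      and_imp]
    exact forall_congr' fun g => forall_comm
  rw [this]
  refine ((finite_orbitBall G o T₁).inter_of_left _).isOpen_biInter fun g _ => ?_
  refine IsClosed.isOpen_compl (self := isClosed_le ?_ continuous_const)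
  exact ((Horocompactification.continuous_eval _ _).const_add _).div_const 2

/-- Outside the radial limit set one eventually stays out of the shadows of all orbit points. This
includes the points of `X`, since the shadows of far away orbit points do not contain them. -/
theorem exists_mem_outsideShadows_of_notMem_radialLimitSet [IsIsometricSMul G X] (o : X) {r : ℝ}
    (hr : 0 ≤ r) {c : Horocompactification X} (hc : c ∉ radialLimitSet G o) :
    ∃ T₀ : ℕ, ∀ T₁, c ∈ outsideShadows G o r T₀ T₁ := by
  suffices ∃ T : ℝ, ∀ g : G, T ≤ dist o (g • o) → c ∉ shadow o (g • o) r by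
    obtain ⟨T, hT⟩ := this
    obtain ⟨n, hn⟩ := exists_nat_ge T
    exact ⟨n, fun T₁ g hg _ => hT g (hn.trans hg)⟩
  by_cases hb : c ∈ horoboundary X
  · by_contra! hcon
    refine hc ⟨r, hr, 1, ?_⟩
    rw [one_smul]
    exact ⟨hb, fun T _ => hcon T⟩
  · obtain ⟨z, rfl⟩ := not_not.1 hb
    refine ⟨dist o z + r + 1, fun g hg hmem => ?_⟩
    have hmem : (dist o (g • o) + (dist (g • o) z - dist o z)) / 2 ≤ r := hmem
    have := dist_triangle o z (g • o)
    rw [dist_comm z] at this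
    linarith

/-- If the series over `V` converges at `σ`, its tail decays exponentially at `ω > σ`. -/
theorem poincareSeries_tail_le (o : X) {σ ω : ℝ} (h : σ ≤ ω) (V : Set G) (T : ℝ) :
    poincareSeries o ω (V ∩ {g | T ≤ dist o (g • o)}) ≤
      ENNReal.ofReal (Real.exp (-(ω - σ) * T)) * poincareSeries o σ V := by
  refine le_trans ?_ (mul_le_mul_right
    (poincareSeries_mono_set o σ (inter_subset_left (t := {g | T ≤ dist o (g • o)}))) _)
  rw [poincareSeries, poincareSeries, ← ENNReal.tsum_mul_left]
  refine ENNReal.tsum_le_tsum fun g => ?_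
  rw [← ENNReal.ofReal_mul (by positivity), ← Real.exp_add]
  refine ENNReal.ofReal_le_ofReal (Real.exp_le_exp.2 ?_)
  have := mul_le_mul_of_nonneg_left (show T ≤ dist o ((g : G) • o) from g.2.2) (sub_nonneg.2 h)
  linarith

theorem tendsto_poincareSeries_top (o : X) {ω : ℝ} {s : ℕ → ℝ} (hlim : Tendsto s atTop (𝓝 ω))
    (h : poincareSeries o ω (univ : Set G) = ⊤) :
    Tendsto (fun n => poincareSeries o (s n) (univ : Set G)) atTop (𝓝 ⊤) := by
  rw [ENNReal.tendsto_nhds_top_iff_nnreal]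
  intro M
  rw [poincareSeries_univ, ENNReal.tsum_eq_iSup_sum] at h
  obtain ⟨Φ, hΦ⟩ := lt_iSup_iff.1 (h ▸ ENNReal.coe_lt_top (r := M))
  have : Tendsto (fun n => ∑ g ∈ Φ, ENNReal.ofReal (Real.exp (-(s n) * dist o (g • o)))) atTop
      (𝓝 (∑ g ∈ Φ, ENNReal.ofReal (Real.exp (-ω * dist o (g • o))))) :=
    tendsto_finsetSum _ fun g _ => ENNReal.tendsto_ofReal
      ((Real.continuous_exp.tendsto _).comp (hlim.neg.mul_const _))
  filter_upwards [this.eventually_const_lt hΦ] with n hn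
  rw [poincareSeries_univ]
  exact hn.trans_le (ENNReal.sum_le_tsum _)

variable [IsIsometricSMul G X] [ProperSpace X] [ProperlyDiscontinuousSMul G X]

/-- A geodesic towards an orbit point outside the shadows at distances between `T₀` and `T₁` makes
an excursion of length about `T₁ - T₀` outside `G K`, and this costs a small factor. -/
theorem poincareSeries_outsideShadows_le (hX : IsGeodesicSpace X) (o : X) {K : Set X}
    (hK : IsCompact K) (hKne : K.Nonempty) {R : ℝ} (hR : K ⊆ Metric.closedBall o R) (hR0 : 0 ≤ R)
    {s T₀ : ℝ} (T₁ : ℝ) (hs : 0 ≤ s) (hT₀ : 0 ≤ T₀) :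
    poincareSeries o s
        {h : G | Horocompactification.ofPoint (h • o) ∈ outsideShadows G o (3 * R) T₀ T₁} ≤
      poincareSeries o s (orbitBall G o (T₀ + 4 * R)) +
      ENNReal.ofReal (Real.exp (s * (8 * R))) *
        (poincareSeries o s (orbitBall G o (T₀ + 4 * R)) *
          poincareSeries o s (awaySet G K ∩ {g | T₁ - T₀ - 4 * R ≤ dist o (g • o)}) *
          poincareSeries o s (univ : Set G)) := by
  obtain ⟨x₀, hx₀⟩ := hKne
  set B := {h : G | Horocompactification.ofPoint (h • o) ∈ outsideShadows G o (3 * R) T₀ T₁}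
  have hsplit : B ⊆ orbitBall G o (T₀ + 4 * R) ∪ (B \ orbitBall G o (T₀ + 4 * R)) := by
    rw [union_sdiff_self]; exact subset_union_right
  refine (poincareSeries_mono_set o s hsplit).trans ((poincareSeries_union_le o s _ _).trans
    (add_le_add le_rfl (poincareSeries_le_mul o hs (8 * R) ?_)))
  rintro h ⟨hB, hlong⟩
  have hlong : T₀ + 4 * R < dist o (h • o) := not_le.1 hlong
  have e1 : dist o x₀ ≤ R := by rw [dist_comm]; exact hR hx₀
  have e2 : dist (h • x₀) (h • o) ≤ R := by rw [dist_smul]; exact hR hx₀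
  have e3 := dist_triangle4 o x₀ (h • x₀) (h • o)
  obtain ⟨u, v, w, rfl, hv, hu, huv, -, hd, hsh⟩ := exists_excursion hX o hK hR hx₀ h
    (t := T₀ + 2 * R) (by linarith) (by linarith)
  have hT₁ : T₁ < dist o ((u * v) • o) := by
    by_contra! hcon
    refine hB (u * v) (by linarith) hcon ?_
    change (dist o ((u * v) • o) +
      (dist ((u * v) • o) ((u * v * w) • o) - dist o ((u * v * w) • o))) / 2 ≤ 3 * R
    linarith
  have htri := dist_triangle o (u • o) ((u * v) • o)
  have e4 : dist (u • o) ((u * v) • o) = dist o (v • o) := by rw [mul_smul, dist_smul]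
  exact ⟨u, by simp only [orbitBall, mem_ofPred_eq]; linarith, v,
    ⟨hv, by simp only [mem_ofPred_eq]; linarith⟩, w, mem_univ _, rfl, hd⟩

/-- A limit of the orbital measures gives full measure to the radial limit set. -/
theorem ae_mem_radialLimitSet (hX : IsGeodesicSpace X) (o : X) {K : Set X}
    (hK : IsCompact K) (hKne : K.Nonempty) {σ ω : ℝ} (hσ : 0 < σ) (hσω : σ < ω)
    (hQ : poincareSeries o σ (awaySet G K) < ⊤)
    (hdiv : poincareSeries o ω (univ : Set G) = ⊤) {s : ℕ → ℝ} (hs : ∀ n, ω ≤ s n)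
    (hlim : Tendsto s atTop (𝓝 ω)) (hP : ∀ n, poincareSeries o (s n) (univ : Set G) < ⊤)
    {ν : Measure (Horocompactification X)}
    (hν : ∀ U, IsOpen U → ν U ≤ limsup (fun n => orbitMeasure G o (s n) U) atTop) :
    ∀ᵐ c ∂ν, c ∈ radialLimitSet G o := by
  obtain ⟨R₀, hR₀⟩ := hK.isBounded.subset_closedBall o
  set R := max R₀ 0 with hRdef
  have hR0 : 0 ≤ R := le_max_right _ _
  have hR : K ⊆ Metric.closedBall o R :=
    hR₀.trans (Metric.closedBall_subset_closedBall (le_max_left _ _))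
  have hω : 0 < ω := hσ.trans hσω
  have hbound : ∀ (T₀ : ℕ) (T₁ : ℝ), ν (outsideShadows G o (3 * R) T₀ T₁) ≤
      ENNReal.ofReal (Real.exp (ω * (8 * R))) * (poincareSeries o ω (orbitBall G o (T₀ + 4 * R)) *
        (ENNReal.ofReal (Real.exp (-(ω - σ) * (T₁ - T₀ - 4 * R))) *
          poincareSeries o σ (awaySet G K))) := by
    intro T₀ T₁
    set B := poincareSeries o ω (orbitBall G o (T₀ + 4 * R))
    set E := ENNReal.ofReal (Real.exp (-(ω - σ) * (T₁ - T₀ - 4 * R))) *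
      poincareSeries o σ (awaySet G K)
    have hBtop : B ≠ ⊤ := (poincareSeries_lt_top_of_finite o ω (finite_orbitBall G o _)).ne
    have hEtop : E ≠ ⊤ := (ENNReal.mul_lt_top ENNReal.ofReal_lt_top hQ).ne
    have hopen := isOpen_outsideShadows (G := G) o (3 * R) T₀ T₁
    have hn : ∀ n, orbitMeasure G o (s n) (outsideShadows G o (3 * R) T₀ T₁) ≤
        (poincareSeries o (s n) (univ : Set G))⁻¹ * B +
          ENNReal.ofReal (Real.exp (s n * (8 * R))) * (B * E) := by
      intro n
      rw [orbitMeasure_apply o (s n) hopen.measurableSet]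
      set P := poincareSeries o (s n) (univ : Set G)
      have hP0 : P ≠ 0 :=
        (one_pos.trans_le (one_le_poincareSeries o (s n) (mem_univ (1 : G)))).ne'
      have h1 := poincareSeries_outsideShadows_le (G := G) hX o hK hKne hR hR0 T₁
        (hω.le.trans (hs n)) T₀.cast_nonneg
      have h2 : poincareSeries o (s n) (orbitBall G o (T₀ + 4 * R)) ≤ B :=
        poincareSeries_anti o (hs n) _
      have h3 : poincareSeries o (s n)
          (awaySet G K ∩ {g | T₁ - T₀ - 4 * R ≤ dist o (g • o)}) ≤ E :=
        (poincareSeries_anti o (hs n) _).trans (poincareSeries_tail_le o hσω.le _ _)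
      calc _ ≤ P⁻¹ * (B + ENNReal.ofReal (Real.exp (s n * (8 * R))) * (B * E * P)) := by
            refine mul_le_mul_right (h1.trans ?_) _
            gcongr
        _ = P⁻¹ * B + ENNReal.ofReal (Real.exp (s n * (8 * R))) * (B * E) * (P⁻¹ * P) := by ring
        _ = _ := by rw [ENNReal.inv_mul_cancel hP0 (hP n).ne, mul_one]
    have hinv : Tendsto (fun n => (poincareSeries o (s n) (univ : Set G))⁻¹ * B) atTop (𝓝 0) := by
      have := ENNReal.Tendsto.mul_const (b := B)
        (tendsto_inv_iff.2 (tendsto_poincareSeries_top o hlim hdiv)) (Or.inr hBtop)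
      simpa using this
    have hexp : Tendsto (fun n => ENNReal.ofReal (Real.exp (s n * (8 * R))) * (B * E)) atTop
        (𝓝 (ENNReal.ofReal (Real.exp (ω * (8 * R))) * (B * E))) :=
      ENNReal.Tendsto.mul_const (ENNReal.tendsto_ofReal
        ((Real.continuous_exp.tendsto _).comp (hlim.mul_const _)))
        (Or.inr (ENNReal.mul_ne_top hBtop hEtop))
    have hsum := hinv.add hexp
    rw [zero_add] at hsum
    exact (hν _ hopen).trans ((limsup_le_limsup (Eventually.of_forall hn)).trans_eq hsum.limsup_eq)
  have hnull : ∀ T₀ : ℕ, ν (⋂ T₁ : ℝ, outsideShadows G o (3 * R) T₀ T₁) = 0 := by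
    intro T₀
    have hexp : Tendsto (fun T₁ : ℝ => ENNReal.ofReal (Real.exp (-(ω - σ) * (T₁ - T₀ - 4 * R))))
        atTop (𝓝 0) := by
      rw [← ENNReal.ofReal_zero]
      refine ENNReal.tendsto_ofReal (Real.tendsto_exp_atBot.comp ?_)
      refine Tendsto.const_mul_atTop_of_neg (by linarith) ?_
      exact tendsto_atTop_add_const_right _ _ (tendsto_atTop_add_const_right _ _ tendsto_id)
    have htend := ENNReal.Tendsto.const_mul
      (a := ENNReal.ofReal (Real.exp (ω * (8 * R))))
      (ENNReal.Tendsto.const_mul (a := poincareSeries o ω (orbitBall G o (T₀ + 4 * R)))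
        (ENNReal.Tendsto.mul_const hexp (Or.inr hQ.ne))
        (Or.inr (poincareSeries_lt_top_of_finite o ω (finite_orbitBall G o _)).ne))
      (Or.inr ENNReal.ofReal_ne_top)
    simp only [zero_mul, mul_zero] at htend
    refine le_antisymm (ge_of_tendsto' htend fun T₁ => ?_) zero_le
    exact (measure_mono (iInter_subset _ T₁)).trans (hbound T₀ T₁)
  rw [ae_iff]
  refine measure_mono_null (fun c hc => ?_) (measure_iUnion_null hnull)
  obtain ⟨T₀, hT₀⟩ := exists_mem_outsideShadows_of_notMem_radialLimitSet (G := G) o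
    (r := 3 * R) (by positivity) hc
  exact mem_iUnion.2 ⟨T₀, mem_iInter.2 hT₀⟩

end RadialLimitSet

/-! ### The conformal density -/

section Density

variable {X : Type*} [MetricSpace X]

/-- The density with `ν` at `o` that is forced by `ω`-conformality. -/
def conformalFamily (ω : ℝ) (o : X) (ν : Measure (Horocompactification X)) (x : X) :
    Measure (Horocompactification X) :=
  ν.withDensity fun c => ENNReal.ofReal (Real.exp (-ω * c.eval x o))

theorem measurable_ofReal_exp_eval (ω : ℝ) (x y : X) :
    Measurable fun c : Horocompactification X => ENNReal.ofReal (Real.exp (-ω * c.eval x y)) :=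
  (ENNReal.continuous_ofReal.comp (Real.continuous_exp.comp
    ((Horocompactification.continuous_eval _ _).const_mul _))).measurable

variable (ω : ℝ) (o : X) (ν : Measure (Horocompactification X))

theorem conformalFamily_self : conformalFamily ω o ν o = ν := by
  simp [conformalFamily, Horocompactification.eval_self]

theorem conformalFamily_eq_withDensity (x y : X) : conformalFamily ω o ν x =
    (conformalFamily ω o ν y).withDensity
      fun c => ENNReal.ofReal (Real.exp (-ω * c.eval x y)) := by
  rw [conformalFamily, conformalFamily, ← withDensity_mul _ (measurable_ofReal_exp_eval ω y o)
    (measurable_ofReal_exp_eval ω x y)]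
  congr 1
  ext c
  rw [Pi.mul_apply, ← ENNReal.ofReal_mul (by positivity), ← Real.exp_add, ← c.eval_add x y o]
  congr 2
  ring

theorem isFiniteMeasure_conformalFamily [IsFiniteMeasure ν] (x : X) :
    IsFiniteMeasure (conformalFamily ω o ν x) := by
  refine isFiniteMeasure_withDensity_ofReal ?_
  exact ((BoundedContinuousFunction.mkOfCompact ⟨_, Real.continuous_exp.comp
    ((Horocompactification.continuous_eval x o).const_mul (-ω))⟩).integrable _).2

theorem isDensity_conformalFamily [IsProbabilityMeasure ν] :
    IsDensity o (conformalFamily ω o ν) where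
  finite := isFiniteMeasure_conformalFamily ω o ν
  absolutelyContinuous x y := by
    rw [conformalFamily_eq_withDensity ω o ν x y]
    exact withDensity_absolutelyContinuous _ _
  normalized := by rw [conformalFamily_self, measure_univ]

theorem isConformalDensity_conformalFamily [IsFiniteMeasure ν] :
    IsConformalDensity ω (conformalFamily ω o ν) := by
  intro x y
  have := isFiniteMeasure_conformalFamily ω o ν y
  rw [conformalFamily_eq_withDensity ω o ν x y]
  exact Measure.rnDeriv_withDensity _ (measurable_ofReal_exp_eval ω x y)

theorem isInvariantDensity_conformalFamily {G : Type*} [Group G] [MulAction G X]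
    [IsIsometricSMul G X] (h : ∀ g : G, ν.map (fun c => g • c) =
      ν.withDensity fun c => ENNReal.ofReal (Real.exp (-ω * c.eval (g • o) o))) :
    IsInvariantDensity G (conformalFamily ω o ν) := by
  intro g x
  have hg : Measurable fun c : Horocompactification X => g • c :=
    (continuous_const_smul g).measurable
  rw [conformalFamily_eq_withDensity ω o ν (g • x) (g • o),
    show conformalFamily ω o ν (g • o) = ν.map (fun c => g • c) from (h g).symm]
  ext A hA
  rw [Measure.map_apply hg hA, conformalFamily, withDensity_apply _ (hg hA),
    withDensity_apply _ hA, setLIntegral_map hA (measurable_ofReal_exp_eval ω _ _) hg]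
  simp only [Horocompactification.eval_smul, inv_smul_smul]

end Density

end

theorem mainTheorem9 {G X : Type*} [Group G] [MetricSpace X] [ProperSpace X]
    [MulAction G X] [IsIsometricSMul G X] [ProperlyDiscontinuousSMul G X]
    (hX : IsGeodesicSpace X) (o : X) (hspr : IsStronglyPositivelyRecurrent G o) :
    (∃ ω : ℝ, (ω : EReal) = groupGrowthRate G o ∧
      ∃ ν : X → Measure (Horocompactification X),
        IsDensity o ν ∧ IsInvariantDensity G ν ∧ IsConformalDensity ω ν ∧
          ∀ x : X, ∀ᵐ c ∂(ν x), c ∈ radialLimitSet G o) ∧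
    IsDivergentAction G o := by
  simp only [IsStronglyPositivelyRecurrent, entropyAtInfinity, iInf_lt_iff] at hspr
  obtain ⟨K, hK, hKne, hlt⟩ := hspr
  obtain ⟨σ, ω, hσ, hσω, hω, hQ, hdiv⟩ :=
    exists_groupGrowthRate_eq_and_poincareSeries_eq_top hX o hK hKne hlt
  set s : ℕ → ℝ := fun n => ω + 1 / ((n : ℝ) + 1) with hsdef
  have hs : ∀ n, ω < s n := fun n => lt_add_of_pos_right _ Nat.one_div_pos_of_nat
  have hlim : Tendsto s atTop (𝓝 ω) := by
    simpa [hsdef] using (tendsto_one_div_add_atTop_nhds_zero_nat (𝕜 := ℝ)).const_add ω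
  have hP : ∀ n, poincareSeries o (s n) (univ : Set G) < ⊤ := by
    intro n
    refine poincareSeries_lt_top_of_growthRate_lt ((hσ.trans hσω).trans (hs n)) ?_
    have : groupGrowthRate G o < s n := by
      rw [← hω]; exact_mod_cast hs n
    exact this
  obtain ⟨ν, hν, hquasi, hopen⟩ := exists_limit_orbitMeasure o (fun n => (hs n).le) hlim hP
  have hrad := ae_mem_radialLimitSet hX o hK hKne hσ hσω hQ hdiv (fun n => (hs n).le) hlim hP hopen
  refine ⟨⟨ω, hω, conformalFamily ω o ν, isDensity_conformalFamily ω o ν,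
    isInvariantDensity_conformalFamily ω o ν hquasi, isConformalDensity_conformalFamily ω o ν,
    fun x => (withDensity_absolutelyContinuous ν _).ae_le hrad⟩, ω, hω, fun hsum => ?_⟩
  rw [poincareSeries_univ] at hdiv
  exact hsum.tsum_ofReal_ne_top hdiv
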